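/- **Setting.** Let $S\subset\mathbb R$ be finite and let $X$ be a random variable with values in $S$. A quantum oracle for $X$ is a unitary $\mathcal O$ on $\mathbb C^S\otimes\mathbb C^W$ ($W$ finite) with $$\mathcal O|0\rangle=\sum_{y\in S}\sqrt{\Pr[X=y]}\,|y\rangle|\psi_y\rangle ,$$ where $|0\rangle$ is a fixed basis state and the $|\psi_y\rangle$ are normalized states. A quantum query algorithm runs circuits made of $\mathcal O$, $\mathcal O^\dagger$ and oracle-independent unitaries on $\mathbb C^S\otimes\mathbb C^W$ and ancillas, measures in the computational basis, and may choose later circuits according to earlier outcomes. Its query complexity is the number of uses of $\mathcal O$ and $\mathcal O^\dagger$ in the worst case. The algorithm knows $S$, $W$ and $|0\rangle$, but not $\mathcal O$ or the law of $X$. A *quantum Monte Carlo mean estimator* $\mathsf{QME}(t,\delta,f)$ is a family of such algorithms, for $f:S\to[0,1]$, integers $t\ge1$ and $0<\delta\le 1/2$, which for universal constants $C_0,C_1$ makes at most $C_1t$ queries and, with $Y=f(X)$, outputs $\hat Y$ such that with probability at least $1-\delta$ $$|\hat Y-\mathbb E[Y]|\le C_0\left(\frac{\sqrt{\mathbb E[Y]}\log(1/\delta)}{t}+\frac{\log^2(1/\delta)}{t^2}\right).$$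 **The estimators.** For an integer $n\ge1$, $c>0$, $B>0$ and $0<\delta<1$ put $k=\lceil\log_2 n\rceil$, $a_{-1}=0$, $a_\ell=\min(2^\ell B/n,\,B)$, $\delta'=\delta/(2(k+1))$ and $t=\Big\lceil c\,n\sqrt{k+1}\;\frac{\log(1/\delta')}{\log(1/\delta)}\Big\rceil$. For a non-negative variable $Y$ that is a function of $X$, $\mathsf{QBME}$ computes for each $0\le\ell\le k$ an estimate $\hat\mu_\ell$ of $\mathbb E[Y\mathbf 1_{a_{\ell-1}\le Y<a_\ell}]/a_\ell$ with $\mathsf{QME}$ (time parameter $t$, failure probability $\delta'$) and outputs $\sum_{\ell=0}^k a_\ell\hat\mu_\ell$. The *Quantum Truncated Mean Estimator* $\mathsf{QTME}(\mathcal O,n,c,B,\delta)$ applies $\mathsf{QBME}$ to $Y_+=X\mathbf 1_{X\ge0}$ and to $Y_-=-X\mathbf 1_{X<0}$ and outputs $\hat\mu=\hat\mu_{Y_+}-\hat\mu_{Y_-}$. **Theorem (mean estimation).** There is a quantum Monte Carlo mean estimator $\mathsf{QME}$ such that the estimator $\mathsf{QTME}$ built on it has the following property. For all $\delta_0<1$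 and $c>0$ there are a constant $C$ and an exponent $r$, depending on nothing else, such that for all $u>0$, $v\in(0,1]$, $\delta\in(0,\delta_0]$, all integers $n\ge1$, every random variable $X$ with finitely many real values and $\mathbb E|X|^{1+v}\le u$, and every quantum oracle $\mathcal O$ for $X$, the algorithm $\mathsf{QTME}(\mathcal O,n,c,B,\delta)$ with $$B=\left(\frac{\sqrt u\,n}{\log(1/\delta)}\right)^{\frac{2}{1+v}}$$ makes at most $C\,n\,(1+\log n)^{r}=\tilde O(n)$ queries to $\mathcal O$ and $\mathcal O^\dagger$, and outputs $\hat\mu$ such that with probability at least $1-\delta$ $$|\hat\mu-\mathbb E[X]|\le C\,\frac{u^{\frac1{1+v}}\,(\log\frac1\delta)^{\frac{2v}{1+v}}}{n^{\frac{2v}{1+v}}}.$$ -/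

import Mathlib

open MeasureTheory
open scoped Kronecker BigOperators

noncomputable section

namespace QTMean

/-! ### Quantum query algorithms

`Q` labels the computational basis of the register on which the oracle acts, `A` labels the
basis of an ancilla register.  An oracle is a unitary matrix indexed by `Q`. -/

/-- One step of a quantum circuit with oracle access: a unitary on the joint register that does
not depend on the oracle, or one use of the oracle `O`, or one use of `O†`. -/
inductive Gate (Q A : Type) [Fintype Q] [DecidableEq Q] [Fintype A] [DecidableEq A] : Type where
  | unitary (U : Matrix.unitaryGroup (Q × A) ℂ)
  | query
  | queryInv

/-- The number of oracle uses of a single step. -/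
def Gate.queries {Q A : Type} [Fintype Q] [DecidableEq Q] [Fintype A] [DecidableEq A] :
    Gate Q A → ℕ
  | .unitary _ => 0
  | .query => 1
  | .queryInv => 1

/-- A unitary `U` on the oracle register, acting as `U ⊗ 1` on the joint register. -/
def tensorOne {Q : Type} (A : Type) [Fintype Q] [DecidableEq Q] [Fintype A] [DecidableEq A]
    (U : Matrix.unitaryGroup Q ℂ) : Matrix.unitaryGroup (Q × A) ℂ :=
  ⟨(U : Matrix Q Q ℂ) ⊗ₖ (1 : Matrix A A ℂ),
    Matrix.kronecker_mem_unitary U.2 (one_mem _)⟩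

/-- The unitary that a step performs when the oracle is `O`. -/
def Gate.toUnitary {Q A : Type} [Fintype Q] [DecidableEq Q] [Fintype A] [DecidableEq A]
    (O : Matrix.unitaryGroup Q ℂ) : Gate Q A → Matrix.unitaryGroup (Q × A) ℂ
  | .unitary U => U
  | .query => tensorOne A O
  | .queryInv => tensorOne A O⁻¹

/-- The unitary performed by a list of steps, the head of the list being performed first. -/
def circuitUnitary {Q A : Type} [Fintype Q] [DecidableEq Q] [Fintype A] [DecidableEq A]
    (O : Matrix.unitaryGroup Q ℂ) : List (Gate Q A) → Matrix.unitaryGroup (Q × A) ℂ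
  | [] => 1
  | g :: gs => circuitUnitary O gs * g.toUnitary O

theorem sum_normSq_col {ι : Type} [Fintype ι] [DecidableEq ι]
    (U : Matrix.unitaryGroup ι ℂ) (i : ι) :
    ∑ b, ENNReal.ofReal (‖(U : Matrix ι ι ℂ) b i‖ ^ 2) = 1 := by
  have h : star (U : Matrix ι ι ℂ) * (U : Matrix ι ι ℂ) = 1 := (Matrix.mem_unitaryGroup_iff').1 U.2
  have h1 := congrFun (congrFun h i) i
  rw [Matrix.mul_apply, Matrix.one_apply_eq] at h1
  have h2 : ((∑ b, ‖(U : Matrix ι ι ℂ) b i‖ ^ 2 : ℝ) : ℂ) = 1 := by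
    rw [← h1]
    push_cast
    refine Finset.sum_congr rfl fun b _ => ?_
    rw [Matrix.star_apply, RCLike.star_def, RCLike.conj_mul]
    rfl
  have h3 : (∑ b, ‖(U : Matrix ι ι ℂ) b i‖ ^ 2 : ℝ) = 1 := by exact_mod_cast h2
  rw [← ENNReal.ofReal_sum_of_nonneg (fun _ _ => by positivity), h3, ENNReal.ofReal_one]

/-- Born's rule: the distribution of the outcome when the circuit `C` is applied to the basis
state `init` and the resulting state is measured in the computational basis. -/
def measure {Q A : Type} [Fintype Q] [DecidableEq Q] [Fintype A] [DecidableEq A]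
    (O : Matrix.unitaryGroup Q ℂ) (init : Q × A) (C : List (Gate Q A)) : PMF (Q × A) :=
  PMF.ofFintype
    (fun b => ENNReal.ofReal
      (‖(circuitUnitary O C : Matrix (Q × A) (Q × A) ℂ) b init‖ ^ 2))
    (sum_normSq_col _ _)

/-- A quantum query algorithm with output in `α`: it either outputs a value, or runs a circuit
on fresh registers, measures them, and continues in a way that may depend on the outcome. -/
inductive QAlg (Q : Type) [Fintype Q] [DecidableEq Q] (α : Type) : Type 1 where
  | output (a : α) : QAlg Q α
  | run {A : Type} [Fintype A] [DecidableEq A] (init : Q × A) (C : List (Gate Q A))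
      (next : Q × A → QAlg Q α) : QAlg Q α

namespace QAlg

variable {Q : Type} [Fintype Q] [DecidableEq Q] {α β : Type}

/-- The distribution of the output when the oracle is `O`. -/
def law (O : Matrix.unitaryGroup Q ℂ) : QAlg Q α → PMF α
  | output a => PMF.pure a
  | run init C next => (measure O init C).bind fun b => law O (next b)

/-- The (worst-case) number of uses of the oracle and of its inverse. -/
def queries : QAlg Q α → ℕ
  | output _ => 0
  | run _ C next => (C.map Gate.queries).sum + Finset.univ.sup fun b => queries (next b)

/-- Run one algorithm, then another one that may use the output of the first. -/
def bind : QAlg Q α → (α → QAlg Q β) → QAlg Q β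
  | output a, f => f a
  | run init C next, f => run init C fun b => bind (next b) f

/-- Run `q 0, …, q (m - 1)` one after the other and output the sum of their outputs. -/
def sumRuns (q : ℕ → QAlg Q ℝ) : ℕ → QAlg Q ℝ
  | 0 => output 0
  | m + 1 => (sumRuns q m).bind fun s => (q m).bind fun x => output (s + x)

end QAlg

/-! ### The oracle of a random variable -/

/-- `O |0⟩ = ∑ y, √(p y) |y⟩ |ψ_y⟩` with normalized states `ψ_y`.  Here `z` is the basis state
`|0⟩`, the first register has basis `L` and the second one, carrying the `ψ_y`, has basis `W`. -/
def Encodes {L W : Type} [Fintype L] [DecidableEq L] [Fintype W] [DecidableEq W]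
    (O : Matrix.unitaryGroup (L × W) ℂ) (z : L × W) (p : L → ℝ) : Prop :=
  ∃ ψ : L → W → ℂ, (∀ y, ∑ w, ‖ψ y w‖ ^ 2 = 1) ∧
    ∀ y w, (O : Matrix (L × W) (L × W) ℂ) (y, w) z = (Real.sqrt (p y) : ℂ) * ψ y w

/-! ### Mean estimation -/

/-- A family of quantum algorithms that receives the registers of the oracle, the basis state
`z = |0⟩`, a function `f` of the label in the first register, a time parameter `t` and a failure
probability `δ`; it is meant to estimate the mean of `f(y)`, with access to the oracle only. -/
def EstimatorFamily : Type 1 :=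
  ∀ (L W : Type) [Fintype L] [DecidableEq L] [Fintype W] [DecidableEq W],
    L × W → (L → ℝ) → ℕ → ℝ → QAlg (L × W) ℝ

/-- The guarantee of a quantum Monte Carlo mean estimator for `[0,1]`-valued variables: for
universal constants `C` and `C'`, at most `C' t` queries, and with probability at least `1 - δ`
an error of at most `C (√E[Y] log(1/δ) / t + log²(1/δ) / t²)`. -/
def IsQME (QME : EstimatorFamily) : Prop :=
  ∃ C C' : ℝ, ∀ (L W : Type) [Fintype L] [DecidableEq L] [Fintype W] [DecidableEq W]
    (z : L × W) (f : L → ℝ) (t : ℕ) (δ : ℝ),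
    (∀ l, 0 ≤ f l ∧ f l ≤ 1) → 1 ≤ t → 0 < δ → δ ≤ 1 / 2 →
      ((QME L W z f t δ).queries : ℝ) ≤ C' * t ∧
      ∀ (O : Matrix.unitaryGroup (L × W) ℂ) (p : L → ℝ), (∀ l, 0 ≤ p l) → Encodes O z p →
        ENNReal.ofReal (1 - δ) ≤
          ((QME L W z f t δ).law O).toMeasure
            {x | |x - ∑ l, p l * f l| ≤
              C * (Real.sqrt (∑ l, p l * f l) * Real.log (1 / δ) / t
                + Real.log (1 / δ) ^ 2 / (t : ℝ) ^ 2)}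

/-- The dyadic grid `a_ℓ = 2 ^ ℓ B / n` of `[0, B]`, capped at `B`. -/
def grid (n : ℕ) (B : ℝ) (l : ℕ) : ℝ := min ((2 : ℝ) ^ l / n * B) B

/-- The left end point of the `ℓ`-th segment: `a_{ℓ-1}`, with `a_{-1} = 0`. -/
def gridLeft (n : ℕ) (B : ℝ) : ℕ → ℝ
  | 0 => 0
  | l + 1 => grid n B l

/-- The index `k = ⌈log₂ n⌉` of the last segment, for which `a_k = B`. -/
def lastIndex (n : ℕ) : ℕ := Nat.clog 2 n

/-- The failure probability allotted to each of the `2 (k + 1)` calls of the subroutine. -/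
def callFailure (n : ℕ) (δ : ℝ) : ℝ := δ / (2 * ((lastIndex n : ℝ) + 1))

/-- The time parameter of each call of the subroutine. -/
def callTime (n : ℕ) (c δ : ℝ) : ℕ :=
  ⌈c * n * Real.sqrt ((lastIndex n : ℝ) + 1)
    * (Real.log (1 / callFailure n δ) / Real.log (1 / δ))⌉₊

variable {L W : Type} [Fintype L] [DecidableEq L] [Fintype W] [DecidableEq W]

/-- The basic estimator of the mean of a non-negative variable `Y` (a function of the label that
the oracle writes): for each segment `[a_{ℓ-1}, a_ℓ)`, `0 ≤ ℓ ≤ k`, the scaled mean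
`E[Y 1_{a_{ℓ-1} ≤ Y < a_ℓ}] / a_ℓ` is estimated with `QME`; the output is `∑ a_ℓ μ̂_ℓ`. -/
def QBME (QME : EstimatorFamily) (z : L × W) (Y : L → ℝ) (n : ℕ) (c B δ : ℝ) :
    QAlg (L × W) ℝ :=
  QAlg.sumRuns (fun l =>
    (QME L W z
      (fun y => if gridLeft n B l ≤ Y y ∧ Y y < grid n B l then Y y / grid n B l else 0)
      (callTime n c δ) (callFailure n δ)).bind
        fun m => QAlg.output (grid n B l * m))
    (lastIndex n + 1)

/-- The truncated mean estimator for the variable `x` (a function of the label that the oracle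
writes): `Y₊ = x 1_{x ≥ 0}` and `Y₋ = -x 1_{x < 0}` are estimated separately. -/
def QTME (QME : EstimatorFamily) (z : L × W) (x : L → ℝ) (n : ℕ) (c B δ : ℝ) :
    QAlg (L × W) ℝ :=
  (QBME QME z (fun y => if 0 ≤ x y then x y else 0) n c B δ).bind fun mPos =>
    (QBME QME z (fun y => if x y < 0 then -x y else 0) n c B δ).bind fun mNeg =>
      QAlg.output (mPos - mNeg)

/-- The truncation level `B = (√u n / log(1/δ)) ^ (2 / (1 + v))`. -/
def truncLevel (u v : ℝ) (n : ℕ) (δ : ℝ) : ℝ :=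
  (Real.sqrt u * n / Real.log (1 / δ)) ^ (2 / (1 + v))

end QTMean

end

noncomputable section

namespace QTMean

/-! ### Probabilities of unwanted events -/

/-! The subroutine is amplitude estimation, amplified by medians. Rotating a flag by `f` after the
oracle gives a state `sin θ · g + cos θ · h` with `sin² θ = E[Y]`. Each Grover step turns it by `2θ`
in the plane of `g` and `h` (`groverStep_blocks`), and the counter value `m` controls how many steps
are made. Fourier inversion of the counter then yields an even mixture of phase estimations for `θ`
and `-θ` (`sum_amplitude_norm_sq`). With the sine window the mean of `sin² (θ - πx/M)` is at most
`(π/2M)²`, so Chebyshev's inequality (`sum_phaseAmp_far_le`) puts the phase within `O(1/M)` with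
probability at least `5/6`. Since `sin² φ - sin² θ = -sin (θ - φ) sin (θ + φ)`, the error in `E[Y]`
is `O(√E[Y]/M + 1/M²)`. Taking `M` of order `t / log(1/δ)` and a median of about `4 log(1/δ)` runs
gives `isQME_medianEstimator`.

For the truncated estimator put `ρ = log(1/δ)/n`. The level `B` is the solution of `B^(1+v) ρ² = u`,
and then `B ρ²` is exactly the claimed rate (`truncLevel_rpow`, `truncLevel_mul`). Truncation at `B`
costs at most `B ρ²` in the mean and leaves a second moment of at most `(Bρ)²`. On a dyadic segment
`a_ℓ` is comparable to `Y`, so the scaled means `μ_ℓ` satisfy `∑ a_ℓ² μ_ℓ ≲ E[Y² 1_{Y<B}] + (B/n)²`.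
By Cauchy–Schwarz the errors `a_ℓ √μ_ℓ` add up to at most a multiple of `√(k+1) · Bρ`, and the
factor `√(k+1)` is absorbed by the time parameter. The result is a total error of order `B ρ²`
(`sum_call_error_le`). A union bound over the `2(k+1)` calls completes the argument. -/

/-- The outer measure of a `PMF` is a plain sum over the set. Bounding failure events by it makes
union bounds free of measurability conditions. -/
theorem one_sub_le_toMeasure_iff {α : Type} [MeasurableSpace α] (p : PMF α) {s : Set α}
    (hs : MeasurableSet s) {δ : ℝ} (hδ : 0 ≤ δ) :
    ENNReal.ofReal (1 - δ) ≤ p.toMeasure s ↔ p.toOuterMeasure sᶜ ≤ ENNReal.ofReal δ := by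
  rw [← p.toMeasure_apply_eq_toOuterMeasure_apply hs.compl, prob_compl_eq_one_sub hs,
    ENNReal.ofReal_sub _ hδ, ENNReal.ofReal_one, tsub_le_iff_right, tsub_le_iff_right, add_comm]

theorem expect_bind {α β : Type} (p : PMF α) (f : α → PMF β) (g : β → ENNReal) :
    ∑' b, (p.bind f) b * g b = ∑' a, p a * ∑' b, f a b * g b := by
  simp_rw [PMF.bind_apply, ← ENNReal.tsum_mul_right, ← ENNReal.tsum_mul_left]
  rw [ENNReal.tsum_comm]
  simp_rw [mul_assoc]

theorem toOuterMeasure_pure_of_notMem {α : Type} {a : α} {s : Set α} (h : a ∉ s) :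
    (PMF.pure a).toOuterMeasure s = 0 := by
  simp [PMF.toOuterMeasure_pure_apply, h]

/-- The union bound for two consecutive random choices. -/
theorem toOuterMeasure_bind_le {α β : Type} (p : PMF α) (f : α → PMF β) {s : Set α} {t : Set β}
    {x y : ENNReal} (hs : p.toOuterMeasure s ≤ x) (ht : ∀ a ∉ s, (f a).toOuterMeasure t ≤ y) :
    (p.bind f).toOuterMeasure t ≤ x + y := by
  rw [PMF.toOuterMeasure_bind_apply]
  calc ∑' a, p a * (f a).toOuterMeasure t
      ≤ ∑' a, (s.indicator p a + p a * y) := by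
        refine ENNReal.tsum_le_tsum fun a => ?_
        by_cases ha : a ∈ s
        · rw [Set.indicator_of_mem ha]
          refine le_add_right ?_
          calc p a * (f a).toOuterMeasure t ≤ p a * 1 := by
                gcongr
                refine ((f a).toOuterMeasure.mono (Set.subset_univ t)).trans ?_
                exact (((f a).toOuterMeasure_apply_eq_one_iff _).2 (Set.subset_univ _)).le
            _ = p a := mul_one _
        · exact le_add_left (by gcongr; exact ht a ha)
    _ = p.toOuterMeasure s + y := by
        rw [ENNReal.tsum_add, ENNReal.tsum_mul_right, p.tsum_coe, one_mul,
          PMF.toOuterMeasure_apply]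
    _ ≤ x + y := by gcongr

namespace QAlg

variable {Q : Type} [Fintype Q] [DecidableEq Q] {α β : Type}

theorem law_bind (O : Matrix.unitaryGroup Q ℂ) (q : QAlg Q α) (f : α → QAlg Q β) :
    law O (q.bind f) = (law O q).bind fun a => law O (f a) := by
  induction q with
  | output a => simp [bind, law]
  | run init C next ih => simp [bind, law, ih]

theorem queries_bind_le (q : QAlg Q α) {f : α → QAlg Q β} {m : ℕ} (hf : ∀ a, (f a).queries ≤ m) :
    (q.bind f).queries ≤ q.queries + m := by
  induction q with
  | output a => simpa [bind, queries] using hf a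
  | run init C next ih =>
    simp only [bind, queries, add_assoc]
    gcongr
    refine Finset.sup_le fun b _ => (ih b).trans ?_
    gcongr
    exact Finset.le_sup (f := fun b => queries (next b)) (Finset.mem_univ b)

theorem sumRuns_queries_le {q : ℕ → QAlg Q ℝ} {N : ℕ} (m : ℕ) (hq : ∀ i, (q i).queries ≤ N) :
    (sumRuns q m).queries ≤ m * N := by
  induction m with
  | zero => simp [sumRuns, queries]
  | succ m ih =>
    rw [Nat.succ_mul, sumRuns]
    refine (queries_bind_le _ fun s => ?_).trans (Nat.add_le_add_right ih N)
    refine (queries_bind_le (m := 0) _ fun x => ?_).trans (hq m)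
    simp [queries]

/-- Union bound for the failures, triangle inequality for the errors. -/
theorem sumRuns_law_le (O : Matrix.unitaryGroup Q ℂ) {q : ℕ → QAlg Q ℝ} {μ e : ℕ → ℝ}
    {ε : ENNReal} (m : ℕ)
    (hq : ∀ i < m, (law O (q i)).toOuterMeasure {x | |x - μ i| ≤ e i}ᶜ ≤ ε) :
    (law O (sumRuns q m)).toOuterMeasure
      {x | |x - ∑ i ∈ Finset.range m, μ i| ≤ ∑ i ∈ Finset.range m, e i}ᶜ ≤ m * ε := by
  induction m with
  | zero =>
    rw [sumRuns, law, toOuterMeasure_pure_of_notMem (by simp)]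
    simp
  | succ m ih =>
    rw [sumRuns, law_bind, Nat.cast_succ, add_mul, one_mul]
    refine toOuterMeasure_bind_le _ _ (ih fun i hi => hq i (hi.trans m.lt_succ_self))
      fun s hs => ?_
    rw [law_bind, ← add_zero ε]
    refine toOuterMeasure_bind_le _ _ (hq m m.lt_succ_self) fun x hx => ?_
    rw [law, toOuterMeasure_pure_of_notMem]
    simp only [Set.mem_compl_iff, Set.mem_ofPred_eq, not_not, Finset.sum_range_succ] at hs hx ⊢
    rw [abs_le] at *
    constructor <;> linarith

/-- Independent repetitions of an algorithm, with all outputs kept. -/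
def repeatRuns (q : QAlg Q α) : (m : ℕ) → QAlg Q (Fin m → α)
  | 0 => output Fin.elim0
  | m + 1 => (repeatRuns q m).bind fun v => q.bind fun x => output (Fin.cons x v)

theorem repeatRuns_queries_le (q : QAlg Q α) (m : ℕ) :
    (repeatRuns q m).queries ≤ m * q.queries := by
  induction m with
  | zero => simp [repeatRuns, queries]
  | succ m ih =>
    rw [Nat.succ_mul, repeatRuns]
    refine (queries_bind_le _ fun s => ?_).trans (Nat.add_le_add_right ih _)
    exact queries_bind_le (m := 0) _ fun x => by simp [queries]

/-- Independence of the runs, in the multiplicative form that an exponential Markov inequality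
needs. -/
theorem expect_repeatRuns (O : Matrix.unitaryGroup Q ℂ) (q : QAlg Q α) (g : α → ENNReal) (m : ℕ) :
    ∑' v, law O (repeatRuns q m) v * ∏ i, g (v i) = (∑' x, law O q x * g x) ^ m := by
  induction m with
  | zero =>
    rw [repeatRuns, law, tsum_eq_single Fin.elim0 fun b hb => absurd (Subsingleton.elim _ _) hb]
    simp [PMF.pure_apply]
  | succ m ih =>
    rw [repeatRuns, law_bind, expect_bind]
    simp_rw [law_bind, expect_bind, law]
    have h (v : Fin m → α) (x : α) :
        ∑' b, (PMF.pure (Fin.cons x v : Fin (m + 1) → α)) b * ∏ i, g (b i) =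
          g x * ∏ i, g (v i) := by
      rw [tsum_eq_single (Fin.cons x v : Fin (m + 1) → α)]
      · simp [Fin.prod_univ_succ]
      · intro b hb
        simp [PMF.pure_apply, hb]
    simp_rw [h, ← mul_assoc, ENNReal.tsum_mul_right]
    rw [pow_succ, ← ih, ← ENNReal.tsum_mul_right]
    exact tsum_congr fun v => by ring

end QAlg

/-! ### Medians -/

/-- A median of a finite family of real numbers. -/
def median {m : ℕ} (v : Fin m → ℝ) : ℝ :=
  sInf {x | m ≤ 2 * (Finset.univ.filter fun i => v i ≤ x).card}

/-- The point `b` has at least half of the values below it, whereas a point left of `a` can only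
have outliers below it. The strict inequality also excludes `m = 0`, where the infimum would be a
default value. -/
theorem median_mem_Icc {m : ℕ} (v : Fin m → ℝ) {a b : ℝ}
    (h : 2 * (Finset.univ.filter fun i => v i ∉ Set.Icc a b).card < m) :
    median v ∈ Set.Icc a b := by
  have hb : b ∈ {x | m ≤ 2 * (Finset.univ.filter fun i => v i ≤ x).card} := by
    have h1 := Finset.card_filter_add_card_filter_not (s := (Finset.univ : Finset (Fin m)))
      (fun i => v i ≤ b)
    have h2 : (Finset.univ.filter fun i => ¬ v i ≤ b).card ≤
        (Finset.univ.filter fun i => v i ∉ Set.Icc a b).card :=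
      Finset.card_le_card (Finset.monotone_filter_right _ fun i _ hi hc => hi hc.2)
    simp only [Finset.card_univ, Fintype.card_fin] at h1
    simp only [Set.mem_ofPred_eq]
    omega
  have ha : a ∈ lowerBounds {x | m ≤ 2 * (Finset.univ.filter fun i => v i ≤ x).card} := by
    intro x hx
    by_contra! hxa
    have h2 : (Finset.univ.filter fun i => v i ≤ x).card ≤
        (Finset.univ.filter fun i => v i ∉ Set.Icc a b).card :=
      Finset.card_le_card (Finset.monotone_filter_right _ fun i _ hi hc =>
        absurd (hc.1.trans hi) (not_le.2 hxa))
    simp only [Set.mem_ofPred_eq] at hx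
    omega
  exact ⟨le_csInf ⟨b, hb⟩ ha, csInf_le ⟨a, ha⟩ hb⟩

/-! ### Amplification of the success probability by medians. -/

namespace QAlg

variable {Q : Type} [Fintype Q] [DecidableEq Q]

/-- The median of independent repetitions of an algorithm. -/
def medianRuns (q : QAlg Q ℝ) (m : ℕ) : QAlg Q ℝ :=
  (repeatRuns q m).bind fun v => output (median v)

theorem medianRuns_queries_le (q : QAlg Q ℝ) (m : ℕ) :
    (medianRuns q m).queries ≤ m * q.queries :=
  (queries_bind_le (m := 0) _ fun x => by simp [queries]).trans (repeatRuns_queries_le q m)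

/-- Chernoff's method: a bad run has weight `4`, a good one weight `1`, so the expected weight of a
run is at most `1 + 3/6 = 3/2`. If at least half of the runs are bad, the product of the weights is
at least `4^(m/2) = 2^m`, and Markov's inequality gives `(3/2)^m / 2^m`. -/
theorem medianRuns_law_le (O : Matrix.unitaryGroup Q ℂ) (q : QAlg Q ℝ) (m : ℕ) {a b : ℝ}
    (h : (law O q).toOuterMeasure (Set.Icc a b)ᶜ ≤ ENNReal.ofReal (1 / 6)) :
    (law O (medianRuns q m)).toOuterMeasure (Set.Icc a b)ᶜ ≤ ENNReal.ofReal ((3 / 4) ^ m) := by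
  classical
  set bad : Set (Fin m → ℝ) :=
    {v | m ≤ 2 * (Finset.univ.filter fun i => v i ∉ Set.Icc a b).card} with hbad
  set g : ℝ → ENNReal := fun x => if x ∉ Set.Icc a b then 4 else 1 with hg
  have hg1 : ∑' x, law O q x * g x ≤ ENNReal.ofReal (3 / 2) := by
    calc ∑' x, law O q x * g x
        = ∑' x, (law O q x + 3 * (Set.Icc a b)ᶜ.indicator (law O q) x) := by
          refine tsum_congr fun x => ?_
          by_cases hx : x ∈ Set.Icc a b
          · rw [Set.indicator_of_notMem (by simpa using hx)]
            simp only [hg, hx, not_true_eq_false, if_false, mul_one, mul_zero, add_zero]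
          · rw [Set.indicator_of_mem (by simpa using hx)]
            simp only [hg, hx, not_false_eq_true, if_true]
            ring
      _ = 1 + 3 * (law O q).toOuterMeasure (Set.Icc a b)ᶜ := by
          rw [ENNReal.tsum_add, ENNReal.tsum_mul_left, PMF.tsum_coe, PMF.toOuterMeasure_apply]
      _ ≤ 1 + 3 * ENNReal.ofReal (1 / 6) := by gcongr
      _ = ENNReal.ofReal (3 / 2) := by
          rw [show (3 : ENNReal) = ENNReal.ofReal 3 by simp,
            ← ENNReal.ofReal_one, ← ENNReal.ofReal_mul (by norm_num),
            ← ENNReal.ofReal_add (by norm_num) (by norm_num)]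
          norm_num
  have hgb : ∀ v ∈ bad, (2 : ENNReal) ^ m ≤ ∏ i, g (v i) := by
    intro v hv
    simp only [hg, Finset.prod_ite, Finset.prod_const, one_pow, mul_one]
    rw [show (4 : ENNReal) = 2 ^ 2 by norm_num, ← pow_mul]
    exact pow_le_pow_right₀ (by norm_num) hv
  have h1 : (2 : ENNReal) ^ m * (law O (repeatRuns q m)).toOuterMeasure bad ≤
      ENNReal.ofReal (3 / 2) ^ m := by
    calc (2 : ENNReal) ^ m * (law O (repeatRuns q m)).toOuterMeasure bad
        ≤ ∑' v, law O (repeatRuns q m) v * ∏ i, g (v i) := by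
          rw [PMF.toOuterMeasure_apply, ← ENNReal.tsum_mul_left]
          refine ENNReal.tsum_le_tsum fun v => ?_
          by_cases hv : v ∈ bad
          · rw [Set.indicator_of_mem hv, mul_comm]
            gcongr
            exact hgb v hv
          · simp [Set.indicator_of_notMem hv]
      _ ≤ _ := by
          rw [expect_repeatRuns]
          gcongr
  have h2 : (law O (repeatRuns q m)).toOuterMeasure bad ≤ ENNReal.ofReal ((3 / 4) ^ m) := by
    have h3 : ENNReal.ofReal (3 / 2) ^ m = 2 ^ m * ENNReal.ofReal ((3 / 4) ^ m) := by
      rw [show (2 : ENNReal) = ENNReal.ofReal 2 by simp, ENNReal.ofReal_pow (by norm_num),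
        ← mul_pow, ← ENNReal.ofReal_mul (by norm_num)]
      norm_num
    rw [h3] at h1
    exact (ENNReal.mul_le_mul_iff_right (by simp) (by simp)).1 h1
  rw [medianRuns, law_bind, ← add_zero (ENNReal.ofReal _)]
  refine toOuterMeasure_bind_le _ _ h2 fun v hv => ?_
  rw [law, toOuterMeasure_pure_of_notMem]
  rw [Set.notMem_compl_iff]
  exact median_mem_Icc v (not_le.1 hv)

end QAlg

/-! ### Unitary matrices -/

section Unitary

variable {ι κ τ : Type} [Fintype ι] [DecidableEq ι] [Fintype κ] [DecidableEq κ]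
  [Fintype τ] [DecidableEq τ]

theorem sum_norm_sq_mulVec (U : Matrix.unitaryGroup ι ℂ) (c : ι → ℂ) :
    ∑ i, ‖((U : Matrix ι ι ℂ).mulVec c) i‖ ^ 2 = ∑ i, ‖c i‖ ^ 2 := by
  have h (v : ι → ℂ) : ((∑ i, ‖v i‖ ^ 2 : ℝ) : ℂ) = star v ⬝ᵥ v := by
    simp only [dotProduct, Pi.star_apply, RCLike.star_def, RCLike.conj_mul]
    push_cast
    rfl
  have hU : star (U : Matrix ι ι ℂ) * (U : Matrix ι ι ℂ) = 1 := (Matrix.mem_unitaryGroup_iff').1 U.2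
  rw [← Complex.ofReal_inj, h, h, Matrix.star_mulVec, Matrix.dotProduct_mulVec,
    Matrix.vecMul_vecMul, ← Matrix.star_eq_conjTranspose, hU, Matrix.vecMul_one]

theorem exists_unitary_col (i₀ : ι) {a : ι → ℂ} (ha : ∑ i, ‖a i‖ ^ 2 = 1) :
    ∃ U : Matrix.unitaryGroup ι ℂ, ∀ i, (U : Matrix ι ι ℂ) i i₀ = a i := by
  have hv : Orthonormal ℂ (({i₀} : Set ι).domRestrict
      (fun _ => (WithLp.toLp 2 a : EuclideanSpace ℂ ι))) := by
    constructor
    · intro i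
      simp [EuclideanSpace.norm_eq, ha]
    · intro i j hij
      exact absurd (Subsingleton.elim i j) hij
  obtain ⟨b, hb⟩ := hv.exists_orthonormalBasis_extension_of_card_eq (by simp)
  refine ⟨⟨(EuclideanSpace.basisFun ι ℂ).toBasis.toMatrix b,
    (EuclideanSpace.basisFun ι ℂ).toMatrix_orthonormalBasis_mem_unitary b⟩, fun i => ?_⟩
  simp [Module.Basis.toMatrix_apply, hb i₀ rfl]

/-- A unitary matrix that maps the basis state `i₀` to the unit vector `a`. -/
def unitaryWithCol (i₀ : ι) (a : ι → ℂ) : Matrix.unitaryGroup ι ℂ :=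
  Classical.epsilon fun U => ∀ i, (U : Matrix ι ι ℂ) i i₀ = a i

theorem unitaryWithCol_apply (i₀ : ι) {a : ι → ℂ} (ha : ∑ i, ‖a i‖ ^ 2 = 1) (i : ι) :
    (unitaryWithCol i₀ a : Matrix ι ι ℂ) i i₀ = a i :=
  Classical.epsilon_spec (exists_unitary_col i₀ ha) i

/-- The unitary that applies `U k` to the first factor when the second factor is in the basis
state `k`, on a register identified with the product by `e`. -/
def controlled (e : ι × κ ≃ τ) (U : κ → Matrix.unitaryGroup ι ℂ) : Matrix.unitaryGroup τ ℂ :=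
  ⟨(Matrix.blockDiagonal fun k => (U k : Matrix ι ι ℂ)).submatrix e.symm e.symm, by
    rw [Matrix.mem_unitaryGroup_iff, Matrix.star_eq_conjTranspose, Matrix.conjTranspose_submatrix,
      Matrix.submatrix_mul_equiv, Matrix.blockDiagonal_conjTranspose, ← Matrix.blockDiagonal_mul]
    have h : (fun k => (U k : Matrix ι ι ℂ) * (U k : Matrix ι ι ℂ).conjTranspose) = 1 :=
      funext fun k => (Matrix.mem_unitaryGroup_iff).1 (U k).2
    rw [h, Matrix.blockDiagonal_one, Matrix.submatrix_one_equiv]⟩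

theorem controlled_mulVec (e : ι × κ ≃ τ) (U : κ → Matrix.unitaryGroup ι ℂ) (s : τ → ℂ)
    (i : ι) (k : κ) :
    ((controlled e U : Matrix τ τ ℂ).mulVec s) (e (i, k)) =
      ((U k : Matrix ι ι ℂ).mulVec fun j => s (e (j, k))) i := by
  simp only [controlled, Matrix.submatrix_mulVec_equiv, Function.comp_apply,
    Equiv.symm_apply_apply, Equiv.symm_symm]
  simp [Matrix.mulVec, dotProduct, Fintype.sum_prod_type, Matrix.blockDiagonal_apply]

open Classical in
/-- The reflection that changes the sign of the basis states in `p`. -/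
def signFlip (p : τ → Prop) : Matrix.unitaryGroup τ ℂ :=
  ⟨Matrix.diagonal fun i => if p i then -1 else 1, by
    rw [Matrix.mem_unitaryGroup_iff, Matrix.star_eq_conjTranspose, Matrix.diagonal_conjTranspose,
      Matrix.diagonal_mul_diagonal, ← Matrix.diagonal_one]
    congr 1
    funext i
    by_cases h : p i <;> simp [h]⟩

open Classical in
theorem signFlip_mulVec (p : τ → Prop) (s : τ → ℂ) (i : τ) :
    ((signFlip p : Matrix τ τ ℂ).mulVec s) i = if p i then -s i else s i := by
  rw [signFlip, Matrix.mulVec_diagonal]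
  split_ifs <;> simp

theorem tensorOne_mulVec (U : Matrix.unitaryGroup ι ℂ) (s : ι × κ → ℂ) (i : ι) (k : κ) :
    ((tensorOne κ U : Matrix (ι × κ) (ι × κ) ℂ).mulVec s) (i, k) =
      ((U : Matrix ι ι ℂ).mulVec fun j => s (j, k)) i := by
  simp [tensorOne, Matrix.mulVec, dotProduct, Fintype.sum_prod_type, Matrix.one_apply]

theorem tensorOne_inv (U : Matrix.unitaryGroup ι ℂ) :
    tensorOne κ U⁻¹ = (tensorOne κ U)⁻¹ := by
  refine Subtype.ext ?_
  change star (U : Matrix ι ι ℂ) ⊗ₖ (1 : Matrix κ κ ℂ) =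
    star ((U : Matrix ι ι ℂ) ⊗ₖ (1 : Matrix κ κ ℂ))
  rw [Matrix.star_eq_conjTranspose, Matrix.star_eq_conjTranspose, Matrix.conjTranspose_kronecker,
    Matrix.conjTranspose_one]

/-- Conjugating the reflection about a basis state by a unitary gives the reflection about the
image of this basis state. -/
theorem conj_reflection_mulVec (U : Matrix.unitaryGroup ι ℂ) (i₀ : ι) (φ : ι → ℂ) :
    (U : Matrix ι ι ℂ).mulVec ((signFlip fun i => i ≠ i₀ : Matrix ι ι ℂ).mulVec
        (((U⁻¹ : Matrix.unitaryGroup ι ℂ) : Matrix ι ι ℂ).mulVec φ)) =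
      fun i => 2 * (∑ j, star ((U : Matrix ι ι ℂ) j i₀) * φ j) * (U : Matrix ι ι ℂ) i i₀ - φ i := by
  have hU : (U : Matrix ι ι ℂ) * ((U⁻¹ : Matrix.unitaryGroup ι ℂ) : Matrix ι ι ℂ) = 1 :=
    (Matrix.mem_unitaryGroup_iff).1 U.2
  set χ := ((U⁻¹ : Matrix.unitaryGroup ι ℂ) : Matrix ι ι ℂ).mulVec φ with hχ
  have h0 : χ i₀ = ∑ j, star ((U : Matrix ι ι ℂ) j i₀) * φ j := rfl
  -- The sign flip off `i₀` is `2 |i₀⟩⟨i₀| - 1`.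
  have h1 : (signFlip fun i => i ≠ i₀ : Matrix ι ι ℂ).mulVec χ =
      (2 * χ i₀) • (Pi.single i₀ 1 : ι → ℂ) - χ := by
    funext i
    rw [signFlip_mulVec]
    by_cases h : i = i₀
    · subst h
      simp
      ring
    · simp [h]
  rw [h1, Matrix.mulVec_sub, Matrix.mulVec_smul, hχ, Matrix.mulVec_mulVec, hU, Matrix.one_mulVec,
    ← hχ, h0]
  funext i
  simp

theorem exists_unit_vector [Nonempty ι] (v : ι → ℂ) :
    ∃ g : ι → ℂ, ∑ i, ‖g i‖ ^ 2 = 1 ∧ ∀ i, v i = (Real.sqrt (∑ j, ‖v j‖ ^ 2) : ℂ) * g i := by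
  by_cases h : ∑ j, ‖v j‖ ^ 2 = 0
  -- The direction of the zero vector is arbitrary. This case occurs when the flag is almost surely
  -- set or almost surely unset.
  · refine ⟨Pi.single (Classical.arbitrary ι) 1, ?_, fun i => ?_⟩
    · rw [Finset.sum_eq_single (Classical.arbitrary ι)] <;> simp +contextual
    · have := (Finset.sum_eq_zero_iff_of_nonneg fun j _ => by positivity).1 h i (Finset.mem_univ i)
      simp_all
  · have hpos : 0 < ∑ j, ‖v j‖ ^ 2 := lt_of_le_of_ne (by positivity) (Ne.symm h)
    have hs : (Real.sqrt (∑ j, ‖v j‖ ^ 2) : ℂ) ≠ 0 := by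
      exact_mod_cast (Real.sqrt_pos.2 hpos).ne'
    refine ⟨fun i => v i / Real.sqrt (∑ j, ‖v j‖ ^ 2), ?_, fun i => by field_simp⟩
    simp only [norm_div, Complex.norm_real, Real.norm_eq_abs, div_pow, sq_abs,
      Real.sq_sqrt hpos.le]
    rw [← Finset.sum_div, div_self h]

end Unitary

/-! ### The discrete Fourier transform and phase estimation -/

/-- A geometric sum of an `M`-th root of unity, which differs from `1` when `m ≠ m'` because `|m -
m'| < M`. -/
theorem sum_dft_mul (M : ℕ) [NeZero M] (m m' : Fin M) :
    ∑ x : Fin M, Complex.exp (2 * Real.pi * Complex.I * ((m : ℂ) - m') / M) ^ (x : ℕ) =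
      if m = m' then (M : ℂ) else 0 := by
  have hM : (M : ℂ) ≠ 0 := Nat.cast_ne_zero.2 (NeZero.ne M)
  split_ifs with h
  · simp [h]
  · set ζ := Complex.exp (2 * Real.pi * Complex.I * ((m : ℂ) - m') / M) with hζ
    have h1 : ζ ^ M = 1 := by
      rw [hζ, ← Complex.exp_nat_mul]
      refine Complex.exp_eq_one_iff.2 ⟨(m : ℤ) - m', ?_⟩
      push_cast
      field_simp
    have h2 : ζ ≠ 1 := by
      intro hc
      obtain ⟨n, hn⟩ := Complex.exp_eq_one_iff.1 hc
      have h3 : ((m : ℂ) - m') = n * M := by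
        have : (2 * Real.pi * Complex.I : ℂ) ≠ 0 := Complex.two_pi_I_ne_zero
        field_simp at hn
        linear_combination hn
      have h4 : ((m : ℤ) - (m' : ℤ)) = n * M := by exact_mod_cast h3
      have h5 : ((m : ℤ) - (m' : ℤ)) = 0 := by
        refine Int.eq_zero_of_abs_lt_dvd (m := (M : ℤ)) ⟨n, by rw [h4, mul_comm]⟩ ?_
        have := m.2
        have := m'.2
        rw [abs_lt]
        constructor <;> omega
      exact h (Fin.ext (by omega))
    rw [Fin.sum_univ_eq_sum_range (fun x => ζ ^ x)]
    have h3 := mul_geom_sum ζ M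
    rw [h1, sub_self] at h3
    exact (mul_eq_zero.1 h3).resolve_left (sub_ne_zero.2 h2)

/-- The inverse of the discrete Fourier transform, as a unitary matrix. -/
def dftInv (M : ℕ) [NeZero M] : Matrix.unitaryGroup (Fin M) ℂ :=
  ⟨Matrix.of fun x m => (1 / Real.sqrt M : ℂ) *
      Complex.exp (-(2 * Real.pi * Complex.I * x * m / M)), by
    have hM : (M : ℂ) ≠ 0 := Nat.cast_ne_zero.2 (NeZero.ne M)
    rw [Matrix.mem_unitaryGroup_iff']
    ext m m'
    rw [Matrix.mul_apply, Matrix.one_apply]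
    have h (x : Fin M) : Complex.exp (2 * Real.pi * Complex.I * x * m / M) *
        Complex.exp (-(2 * Real.pi * Complex.I * x * m' / M)) =
          Complex.exp (2 * Real.pi * Complex.I * ((m : ℂ) - m') / M) ^ (x : ℕ) := by
      rw [← Complex.exp_add, ← Complex.exp_nat_mul]
      congr 1
      field_simp
      ring
    have h2 : (1 / Real.sqrt M : ℂ) * (1 / Real.sqrt M) = 1 / M := by
      rw [div_mul_div_comm, one_mul, ← Complex.ofReal_mul, Real.mul_self_sqrt (by positivity)]
      simp
    calc ∑ x : Fin M, _
        = ∑ x : Fin M, (1 / M : ℂ) *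
            Complex.exp (2 * Real.pi * Complex.I * ((m : ℂ) - m') / M) ^ (x : ℕ) := by
          refine Finset.sum_congr rfl fun x _ => ?_
          rw [← h, ← h2]
          simp only [Matrix.star_apply, Matrix.of_apply, RCLike.star_def, map_mul, map_div₀,
            map_one, Complex.conj_ofReal, ← Complex.exp_conj, map_neg, Complex.conj_I,
            map_ofNat, map_natCast]
          ring_nf
      _ = _ := by
          rw [← Finset.mul_sum, sum_dft_mul]
          split_ifs <;> simp [hM]⟩

theorem dftInv_apply (M : ℕ) [NeZero M] (x m : Fin M) :
    (dftInv M : Matrix (Fin M) (Fin M) ℂ) x m =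
      (1 / Real.sqrt M : ℂ) * Complex.exp (-(2 * Real.pi * Complex.I * x * m / M)) := rfl

/-- The amplitude of the outcome `x` of phase estimation with window `w` and phase `2θ`. -/
def phaseAmp (M : ℕ) [NeZero M] (w : ℕ → ℝ) (θ : ℝ) (x : Fin M) : ℂ :=
  ((dftInv M : Matrix (Fin M) (Fin M) ℂ).mulVec
    fun m => (w m : ℂ) * Complex.exp (Complex.I * ((2 * (m : ℕ) + 1) * θ))) x

theorem phaseAmp_eq (M : ℕ) [NeZero M] (w : ℕ → ℝ) (θ : ℝ) (x : Fin M) :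
    phaseAmp M w θ x = (1 / Real.sqrt M : ℂ) * Complex.exp (Complex.I * θ) *
      ∑ m ∈ Finset.range M,
        (w m : ℂ) * Complex.exp (Complex.I * (2 * (θ - Real.pi * x / M) : ℝ)) ^ m := by
  rw [phaseAmp, Matrix.mulVec, dotProduct, ← Fin.sum_univ_eq_sum_range
    (fun m => (w m : ℂ) * Complex.exp (Complex.I * (2 * (θ - Real.pi * x / M) : ℝ)) ^ m),
    Finset.mul_sum]
  refine Finset.sum_congr rfl fun m _ => ?_
  have h : Complex.exp (-(2 * Real.pi * Complex.I * x * m / M)) *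
      Complex.exp (Complex.I * ((2 * (m : ℕ) + 1) * θ)) = Complex.exp (Complex.I * θ) *
        Complex.exp (Complex.I * (2 * (θ - Real.pi * x / M) : ℝ)) ^ (m : ℕ) := by
    rw [← Complex.exp_nat_mul, ← Complex.exp_add, ← Complex.exp_add]
    congr 1
    push_cast
    ring
  rw [dftInv_apply]
  linear_combination (1 / Real.sqrt M : ℂ) * (w m : ℂ) * h

/-- Summation by parts; the boundary terms vanish because the window is zero at both ends. -/
theorem phaseAmp_sub (M : ℕ) [NeZero M] {w : ℕ → ℝ} (h0 : w 0 = 0) (hM : w M = 0) (θ : ℝ)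
    (x : Fin M) :
    (Complex.exp (Complex.I * (2 * (θ - Real.pi * x / M) : ℝ)) - 1) * phaseAmp M w θ x =
      Complex.exp (Complex.I * (2 * (θ - Real.pi * x / M) : ℝ)) *
        phaseAmp M (fun m => w m - w (m + 1)) θ x := by
  rw [phaseAmp_eq, phaseAmp_eq]
  set ζ := Complex.exp (Complex.I * (2 * (θ - Real.pi * x / M) : ℝ))
  have h1 := Finset.sum_range_succ (fun m => (w m : ℂ) * ζ ^ m) M
  rw [Finset.sum_range_succ'] at h1
  simp only [h0, hM, Complex.ofReal_zero, zero_mul, add_zero] at h1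
  have h2 : ζ * ∑ m ∈ Finset.range M, ((w m - w (m + 1) : ℝ) : ℂ) * ζ ^ m =
      ζ * ∑ m ∈ Finset.range M, (w m : ℂ) * ζ ^ m -
        ∑ m ∈ Finset.range M, (w (m + 1) : ℂ) * ζ ^ (m + 1) := by
    rw [Finset.mul_sum, Finset.mul_sum, ← Finset.sum_sub_distrib]
    refine Finset.sum_congr rfl fun m _ => ?_
    push_cast
    ring
  rw [h1] at h2
  linear_combination -(1 / Real.sqrt M : ℂ) * Complex.exp (Complex.I * θ) * h2

theorem sum_phaseAmp_sq (M : ℕ) [NeZero M] (w : ℕ → ℝ) (θ : ℝ) :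
    ∑ x, ‖phaseAmp M w θ x‖ ^ 2 = ∑ m ∈ Finset.range M, w m ^ 2 := by
  rw [← Fin.sum_univ_eq_sum_range (fun m => w m ^ 2)]
  refine (sum_norm_sq_mulVec (dftInv M) _).trans (Finset.sum_congr rfl fun m _ => ?_)
  rw [norm_mul, show (Complex.I * ((2 * ((m : ℕ) : ℂ) + 1) * θ)) =
    Complex.I * ((2 * (m : ℕ) + 1) * θ : ℝ) by push_cast; ring, Complex.norm_exp_I_mul_ofReal]
  simp

/-- Since `|exp(2iφ) - 1| = 2|sin φ|`, Parseval's identity for the differenced window turns the mean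
square deviation of the phase into the discrete Dirichlet energy of the window. -/
theorem sum_phaseAmp_sin_sq (M : ℕ) [NeZero M] {w : ℕ → ℝ} (h0 : w 0 = 0) (hM : w M = 0) (θ : ℝ) :
    ∑ x, ‖phaseAmp M w θ x‖ ^ 2 * (2 * Real.sin (θ - Real.pi * x / M)) ^ 2 =
      ∑ m ∈ Finset.range M, (w m - w (m + 1)) ^ 2 := by
  rw [← sum_phaseAmp_sq M (fun m => w m - w (m + 1)) θ]
  refine Finset.sum_congr rfl fun x _ => ?_
  have h := congrArg norm (phaseAmp_sub M h0 hM θ x)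
  rw [norm_mul, norm_mul, Complex.norm_exp_I_mul_ofReal, Complex.norm_exp_I_mul_ofReal_sub_one,
    one_mul, Real.norm_eq_abs, mul_div_cancel_left₀ _ (two_ne_zero)] at h
  rw [← h, mul_pow |2 * Real.sin _|, sq_abs, mul_comm]

/-- The sine window on `{0, …, M - 1}`, normalized. -/
def window (M : ℕ) (m : ℕ) : ℝ :=
  Real.sin (Real.pi * m / M) / Real.sqrt (∑ j ∈ Finset.range M, Real.sin (Real.pi * j / M) ^ 2)

theorem window_zero (M : ℕ) : window M 0 = 0 := by simp [window]

theorem window_self (M : ℕ) (hM : M ≠ 0) : window M M = 0 := by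
  rw [window, mul_div_assoc, div_self (by exact_mod_cast hM)]
  simp

theorem sum_window_sq {M : ℕ} (hM : 2 ≤ M) : ∑ m ∈ Finset.range M, window M m ^ 2 = 1 := by
  have hpos : 0 < ∑ j ∈ Finset.range M, Real.sin (Real.pi * j / M) ^ 2 := by
    refine Finset.sum_pos' (fun j _ => sq_nonneg _) ⟨1, Finset.mem_range.2 (by omega), ?_⟩
    have hM' : (2 : ℝ) ≤ M := by exact_mod_cast hM
    refine pow_pos (Real.sin_pos_of_pos_of_lt_pi ?_ ?_) 2
    · have := Real.pi_pos
      positivity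
    · rw [Nat.cast_one, mul_one, div_lt_iff₀ (by linarith)]
      nlinarith [Real.pi_pos]
  simp only [window, div_pow, Real.sq_sqrt hpos.le]
  rw [← Finset.sum_div, div_self hpos.ne']

/-- The sine window is an eigenvector of the path with zero boundary values, which makes its energy
computable. -/
theorem window_add_two (M m : ℕ) :
    window M m + window M (m + 2) = 2 * Real.cos (Real.pi / M) * window M (m + 1) := by
  simp only [window]
  rw [← add_div, ← mul_div_assoc]
  congr 1
  rw [show Real.pi * (m : ℕ) / M = Real.pi * (m + 1 : ℕ) / M - Real.pi / M by push_cast; ring,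
    show Real.pi * (m + 2 : ℕ) / M = Real.pi * (m + 1 : ℕ) / M + Real.pi / M by push_cast; ring,
    Real.sin_sub, Real.sin_add]
  ring

/-- Expanding the square leaves the correlation of neighbours, which the eigenvector equation
evaluates to `cos (π/M)`. The energy is `2 - 2 cos (π/M)`. -/
theorem sum_window_sub_sq_le {M : ℕ} (hM : 2 ≤ M) :
    ∑ m ∈ Finset.range M, (window M m - window M (m + 1)) ^ 2 ≤ (Real.pi / M) ^ 2 := by
  have hw0 := window_zero M
  have hwM := window_self M (by omega)
  have h1 : ∑ m ∈ Finset.range M, window M (m + 1) ^ 2 = 1 := by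
    have h := Finset.sum_range_succ (fun m => window M m ^ 2) M
    rw [Finset.sum_range_succ'] at h
    simp only [hw0, hwM] at h
    rw [← sum_window_sq hM]
    simpa using h
  have h2 : ∑ m ∈ Finset.range M, window M (m + 1) * window M (m + 2) =
      ∑ m ∈ Finset.range M, window M m * window M (m + 1) := by
    have h := Finset.sum_range_succ (fun m => window M m * window M (m + 1)) M
    rw [Finset.sum_range_succ'] at h
    simp only [hw0, hwM] at h
    simpa using h
  have h3 : 2 * ∑ m ∈ Finset.range M, window M m * window M (m + 1) =
      2 * Real.cos (Real.pi / M) := by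
    rw [two_mul]
    nth_rw 2 [← h2]
    rw [← Finset.sum_add_distrib]
    calc _ = ∑ m ∈ Finset.range M, 2 * Real.cos (Real.pi / M) * window M (m + 1) ^ 2 := by
          refine Finset.sum_congr rfl fun m _ => ?_
          linear_combination window M (m + 1) * window_add_two M m
      _ = _ := by rw [← Finset.mul_sum, h1, mul_one]
  have h4 : ∑ m ∈ Finset.range M, (window M m - window M (m + 1)) ^ 2 =
      1 + 1 - 2 * Real.cos (Real.pi / M) := by
    rw [← h3, Finset.mul_sum]
    nth_rw 1 [← sum_window_sq hM]
    rw [← h1, ← Finset.sum_add_distrib, ← Finset.sum_sub_distrib]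
    exact Finset.sum_congr rfl fun m _ => by ring
  rw [h4]
  linarith [Real.one_sub_sq_div_two_le_cos (x := Real.pi / M)]

/-! ### Amplitude estimation -/

section AmplitudeEstimation

variable {Q : Type} [Fintype Q] [DecidableEq Q]

/-- The state of the joint register after a circuit. -/
def runCircuit {A : Type} [Fintype A] [DecidableEq A] (O : Matrix.unitaryGroup Q ℂ)
    (C : List (Gate Q A)) (s : Q × A → ℂ) : Q × A → ℂ :=
  (circuitUnitary O C : Matrix (Q × A) (Q × A) ℂ).mulVec s

theorem runCircuit_nil {A : Type} [Fintype A] [DecidableEq A] (O : Matrix.unitaryGroup Q ℂ)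
    (s : Q × A → ℂ) : runCircuit O [] s = s := by
  simp [runCircuit, circuitUnitary]

theorem runCircuit_cons {A : Type} [Fintype A] [DecidableEq A] (O : Matrix.unitaryGroup Q ℂ)
    (g : Gate Q A) (C : List (Gate Q A)) (s : Q × A → ℂ) :
    runCircuit O (g :: C) s =
      runCircuit O C ((g.toUnitary O : Matrix (Q × A) (Q × A) ℂ).mulVec s) := by
  simp [runCircuit, circuitUnitary, Matrix.mulVec_mulVec]

theorem runCircuit_append {A : Type} [Fintype A] [DecidableEq A] (O : Matrix.unitaryGroup Q ℂ)
    (C D : List (Gate Q A)) (s : Q × A → ℂ) :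
    runCircuit O (C ++ D) s = runCircuit O D (runCircuit O C s) := by
  induction C generalizing s with
  | nil => simp [runCircuit_nil]
  | cons g C ih => rw [List.cons_append, runCircuit_cons, runCircuit_cons, ih]

theorem measure_apply {A : Type} [Fintype A] [DecidableEq A] (O : Matrix.unitaryGroup Q ℂ)
    (i : Q × A) (C : List (Gate Q A)) (b : Q × A) :
    measure O i C b = ENNReal.ofReal (‖runCircuit O C (Pi.single i 1) b‖ ^ 2) := by
  rw [measure, PMF.ofFintype_apply, runCircuit, Matrix.mulVec_single_one, Matrix.col_apply]

/-- The rotation of a flag that marks the basis state `q` with probability `f q`. -/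
def flagRotation (f : Q → ℝ) : Matrix.unitaryGroup (Q × Bool) ℂ :=
  controlled (Equiv.prodComm Bool Q) fun q => unitaryWithCol false fun b =>
    if b then (Real.sqrt (f q) : ℂ) else Real.sqrt (1 - f q)

/-- The oracle followed by the rotation of the flag. -/
def flaggedOracle (O : Matrix.unitaryGroup Q ℂ) (f : Q → ℝ) : Matrix.unitaryGroup (Q × Bool) ℂ :=
  flagRotation f * tensorOne Bool O

theorem flaggedOracle_apply (O : Matrix.unitaryGroup Q ℂ) {f : Q → ℝ}
    (hf : ∀ q, 0 ≤ f q ∧ f q ≤ 1) (z q : Q) (b : Bool) :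
    (flaggedOracle O f : Matrix (Q × Bool) (Q × Bool) ℂ) (q, b) (z, false) =
      (O : Matrix Q Q ℂ) q z * if b then (Real.sqrt (f q) : ℂ) else Real.sqrt (1 - f q) := by
  have h1 : (tensorOne Bool O : Matrix (Q × Bool) (Q × Bool) ℂ).mulVec (Pi.single (z, false) 1) =
      fun i => (O : Matrix Q Q ℂ) i.1 z * (if i.2 = false then 1 else 0) := by
    funext i
    simp [tensorOne, Matrix.one_apply]
  have h2 : (flaggedOracle O f : Matrix (Q × Bool) (Q × Bool) ℂ) (q, b) (z, false) =
      (flaggedOracle O f : Matrix (Q × Bool) (Q × Bool) ℂ).mulVec (Pi.single (z, false) 1) (q, b) := by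
    simp
  have h3 : ((flaggedOracle O f : Matrix.unitaryGroup (Q × Bool) ℂ) :
      Matrix (Q × Bool) (Q × Bool) ℂ) = (flagRotation f : Matrix (Q × Bool) (Q × Bool) ℂ) *
        (tensorOne Bool O : Matrix (Q × Bool) (Q × Bool) ℂ) := rfl
  rw [h2, h3, ← Matrix.mulVec_mulVec, h1, flagRotation,
    show (q, b) = Equiv.prodComm Bool Q (b, q) from rfl, controlled_mulVec]
  simp only [Equiv.prodComm_apply, Prod.swap_prod_mk, Matrix.mulVec, dotProduct,
    Fintype.sum_bool, Bool.true_eq_false, if_false, mul_zero, zero_add, if_true, mul_one]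
  rw [unitaryWithCol_apply, mul_comm]
  simp [Real.sq_sqrt (hf q).1, Real.sq_sqrt (sub_nonneg.2 (hf q).2)]

variable {M : ℕ}

/-- The state of a register and a counter whose component at the counter value `m` is `Φ m`. -/
def blocks (Φ : Fin M → Q × Bool → ℂ) : Q × (Bool × Fin M) → ℂ :=
  fun i => Φ i.2.2 (i.1, i.2.1)

/-- A unitary on the oracle register and the flag. -/
def onFlagged (M : ℕ) (U : Matrix.unitaryGroup (Q × Bool) ℂ) : Gate Q (Bool × Fin M) :=
  .unitary (controlled (Equiv.prodAssoc Q Bool (Fin M)) fun _ => U)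

/-- A unitary on the counter. -/
def onCounter (Q : Type) [Fintype Q] [DecidableEq Q] (V : Matrix.unitaryGroup (Fin M) ℂ) :
    Gate Q (Bool × Fin M) :=
  .unitary (controlled ((Equiv.prodComm (Fin M) (Q × Bool)).trans (Equiv.prodAssoc Q Bool (Fin M)))
    fun _ => V)

/-- The reflection about the complement of `p` where the counter exceeds `j`. -/
def signFlipAbove (M : ℕ) (j : ℕ) (p : Q × Bool → Prop) : Gate Q (Bool × Fin M) :=
  .unitary (signFlip fun i => p (i.1, i.2.1) ∧ j < i.2.2)

theorem onFlagged_blocks (O : Matrix.unitaryGroup Q ℂ) (U : Matrix.unitaryGroup (Q × Bool) ℂ)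
    (Φ : Fin M → Q × Bool → ℂ) :
    ((onFlagged M U).toUnitary O : Matrix _ _ ℂ).mulVec (blocks Φ) =
      blocks fun m => (U : Matrix (Q × Bool) (Q × Bool) ℂ).mulVec (Φ m) := by
  funext ⟨q, b, m⟩
  exact controlled_mulVec (Equiv.prodAssoc Q Bool (Fin M)) (fun _ => U) (blocks Φ) (q, b) m

theorem onCounter_blocks (O : Matrix.unitaryGroup Q ℂ) (V : Matrix.unitaryGroup (Fin M) ℂ)
    (Φ : Fin M → Q × Bool → ℂ) :
    ((onCounter Q V).toUnitary O : Matrix _ _ ℂ).mulVec (blocks Φ) =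
      blocks fun x i => (V : Matrix (Fin M) (Fin M) ℂ).mulVec (fun m => Φ m i) x := by
  funext ⟨q, b, m⟩
  exact controlled_mulVec
    ((Equiv.prodComm (Fin M) (Q × Bool)).trans (Equiv.prodAssoc Q Bool (Fin M)))
    (fun _ => V) (blocks Φ) m (q, b)

theorem signFlipAbove_blocks (O : Matrix.unitaryGroup Q ℂ) (j : ℕ) (p : Q × Bool → Prop)
    (Φ : Fin M → Q × Bool → ℂ) :
    ((signFlipAbove M j p).toUnitary O : Matrix _ _ ℂ).mulVec (blocks Φ) =
      blocks fun m => if j < m then (signFlip p : Matrix (Q × Bool) (Q × Bool) ℂ).mulVec (Φ m)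
        else Φ m := by
  funext ⟨q, b, m⟩
  simp only [signFlipAbove, Gate.toUnitary, signFlip_mulVec, blocks]
  by_cases hj : j < m
  · by_cases hp : p (q, b) <;> simp [hj, hp, signFlip_mulVec]
  · simp [hj]

theorem query_blocks (O : Matrix.unitaryGroup Q ℂ) (Φ : Fin M → Q × Bool → ℂ) :
    ((Gate.query : Gate Q (Bool × Fin M)).toUnitary O : Matrix _ _ ℂ).mulVec (blocks Φ) =
      blocks fun m => (tensorOne Bool O : Matrix (Q × Bool) (Q × Bool) ℂ).mulVec (Φ m) := by
  funext ⟨q, b, m⟩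
  simp only [Gate.toUnitary, tensorOne_mulVec, blocks]

theorem queryInv_blocks (O : Matrix.unitaryGroup Q ℂ) (Φ : Fin M → Q × Bool → ℂ) :
    ((Gate.queryInv : Gate Q (Bool × Fin M)).toUnitary O : Matrix _ _ ℂ).mulVec (blocks Φ) =
      blocks fun m => ((tensorOne Bool O)⁻¹ : Matrix.unitaryGroup (Q × Bool) ℂ).1.mulVec (Φ m) := by
  funext ⟨q, b, m⟩
  rw [← tensorOne_inv]
  simp only [Gate.toUnitary, tensorOne_mulVec, blocks]

/-- One amplification step, performed where the counter exceeds `j`. -/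
def groverStep (M : ℕ) (z : Q) (f : Q → ℝ) (j : ℕ) : List (Gate Q (Bool × Fin M)) :=
  [signFlipAbove M j fun i => i.2 = true, onFlagged M (flagRotation f)⁻¹, .queryInv,
    signFlipAbove M j fun i => i ≠ (z, false), .query, onFlagged M (flagRotation f)]

/-- Phase estimation, with the sine window, for the amplification steps. -/
def amplitudeCircuit (M : ℕ) [NeZero M] (z : Q) (f : Q → ℝ) : List (Gate Q (Bool × Fin M)) :=
  onCounter Q (unitaryWithCol (0 : Fin M) fun m => (window M m : ℂ)) :: .query ::
    onFlagged M (flagRotation f) ::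
      ((List.range M).flatMap (groverStep M z f) ++ [onCounter Q (dftInv M)])

/-- The amplitude estimation algorithm: an estimate of the probability that the flag is set. -/
def amplitudeEstimate (M : ℕ) [NeZero M] (z : Q) (f : Q → ℝ) : QAlg Q ℝ :=
  .run (z, (false, (0 : Fin M))) (amplitudeCircuit M z f) fun b =>
    .output (Real.sin (Real.pi * b.2.2 / M) ^ 2)

theorem amplitudeEstimate_queries (M : ℕ) [NeZero M] (z : Q) (f : Q → ℝ) :
    (amplitudeEstimate M z f).queries ≤ 2 * M + 1 := by
  have h (n : ℕ) : ((((List.range n).flatMap (groverStep M z f))).map Gate.queries).sum = 2 * n := by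
    induction n with
    | zero => simp
    | succ n ih =>
      simp only [List.range_succ, List.flatMap_append, List.map_append, List.sum_append, ih]
      simp [groverStep, Gate.queries, signFlipAbove, onFlagged]
      ring
  simp only [amplitudeEstimate, QAlg.queries, amplitudeCircuit, List.map_cons, List.sum_cons,
    List.map_append, List.sum_append, h]
  have h0 : (Finset.univ.sup fun _ : Q × Bool × Fin M => 0) = 0 := Finset.sup_bot _
  simp only [onCounter, onFlagged, Gate.queries, List.map_nil, List.sum_nil, h0]
  omega

theorem flaggedOracle_mulVec (O : Matrix.unitaryGroup Q ℂ) (f : Q → ℝ) (φ : Q × Bool → ℂ) :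
    (flagRotation f : Matrix (Q × Bool) (Q × Bool) ℂ).mulVec
      ((tensorOne Bool O : Matrix (Q × Bool) (Q × Bool) ℂ).mulVec φ) =
      (flaggedOracle O f : Matrix (Q × Bool) (Q × Bool) ℂ).mulVec φ :=
  Matrix.mulVec_mulVec ..

theorem flaggedOracle_inv_mulVec (O : Matrix.unitaryGroup Q ℂ) (f : Q → ℝ) (φ : Q × Bool → ℂ) :
    ((tensorOne Bool O)⁻¹ : Matrix.unitaryGroup (Q × Bool) ℂ).1.mulVec
      (((flagRotation f)⁻¹ : Matrix.unitaryGroup (Q × Bool) ℂ).1.mulVec φ) =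
      ((flaggedOracle O f)⁻¹ : Matrix.unitaryGroup (Q × Bool) ℂ).1.mulVec φ := by
  rw [flaggedOracle, mul_inv_rev, Matrix.mulVec_mulVec]
  rfl

/-- A point of the circle through the unit vectors `g` and `h`. -/
def circlePoint {ι : Type} (g h : ι → ℂ) (α : ℝ) : ι → ℂ :=
  fun i => (Real.sin α : ℂ) * g i + (Real.cos α : ℂ) * h i

/-- Disjoint supports make `g` and `h` orthonormal, so this is the addition formula for the cosine.
-/
theorem sum_star_circlePoint {ι : Type} [Fintype ι] {g h : ι → ℂ} (hg : ∑ i, ‖g i‖ ^ 2 = 1)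
    (hh : ∑ i, ‖h i‖ ^ 2 = 1) (hgh : ∀ i, g i = 0 ∨ h i = 0) (α β : ℝ) :
    ∑ i, star (circlePoint g h α i) * circlePoint g h β i = Real.cos (α - β) := by
  have h1 (i : ι) : star (circlePoint g h α i) * circlePoint g h β i =
      (Real.sin α * Real.sin β : ℂ) * ((‖g i‖ ^ 2 : ℝ) : ℂ) +
        (Real.cos α * Real.cos β : ℂ) * ((‖h i‖ ^ 2 : ℝ) : ℂ) := by
    push_cast
    rw [← Complex.conj_mul', ← Complex.conj_mul']
    simp only [circlePoint, RCLike.star_def, map_add, map_mul, Complex.conj_ofReal]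
    rcases hgh i with h | h <;> simp only [h, map_zero, Complex.ofReal_sin, Complex.ofReal_cos] <;> ring
  simp_rw [h1]
  rw [Finset.sum_add_distrib, ← Finset.mul_sum, ← Finset.mul_sum, ← Complex.ofReal_sum,
    ← Complex.ofReal_sum, hg, hh, Real.cos_sub]
  push_cast
  ring

/-- Two reflections compose to a rotation: the flag reflection sends the angle `α` to `-α`, and the
reflection about the flagged state, at angle `θ`, sends `-α` to `2θ + α`. -/
theorem groverStep_blocks (O : Matrix.unitaryGroup Q ℂ) (z : Q) (f : Q → ℝ)
    {g h : Q × Bool → ℂ} {θ : ℝ} (hg : ∑ i, ‖g i‖ ^ 2 = 1) (hh : ∑ i, ‖h i‖ ^ 2 = 1)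
    (hg0 : ∀ q, g (q, false) = 0) (hh0 : ∀ q, h (q, true) = 0)
    (hcol : ∀ i, (flaggedOracle O f : Matrix (Q × Bool) (Q × Bool) ℂ) i (z, false) =
      circlePoint g h θ i) (w : ℕ → ℝ) (j : ℕ) :
    runCircuit O (groverStep M z f j)
        (blocks fun m i => (w m : ℂ) * circlePoint g h ((2 * (min m j : ℕ) + 1) * θ) i) =
      blocks fun m i => (w m : ℂ) * circlePoint g h ((2 * (min m (j + 1) : ℕ) + 1) * θ) i := by
  simp only [groverStep, runCircuit_cons, runCircuit_nil, signFlipAbove_blocks, onFlagged_blocks,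
    queryInv_blocks, query_blocks, flaggedOracle_mulVec, flaggedOracle_inv_mulVec]
  congr 1
  funext m
  by_cases hj : j < m
  · simp only [hj, if_true, min_eq_right hj.le, min_eq_right (Nat.succ_le_of_lt hj)]
    have h1 : (signFlip fun i : Q × Bool => i.2 = true : Matrix (Q × Bool) (Q × Bool) ℂ).mulVec
        (fun i => (w m : ℂ) * circlePoint g h ((2 * (j : ℕ) + 1) * θ) i) =
          fun i => (w m : ℂ) * circlePoint g h (-((2 * (j : ℕ) + 1) * θ)) i := by
      funext ⟨q, b⟩
      rw [signFlip_mulVec]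
      cases b <;> simp [circlePoint, hg0, hh0]
    have hgh : ∀ i, g i = 0 ∨ h i = 0 := by
      rintro ⟨q, b⟩
      cases b
      · exact Or.inl (hg0 q)
      · exact Or.inr (hh0 q)
    rw [h1, conj_reflection_mulVec]
    funext i
    have h2 : ∑ i, star ((flaggedOracle O f : Matrix (Q × Bool) (Q × Bool) ℂ) i (z, false)) *
        ((w m : ℂ) * circlePoint g h (-((2 * (j : ℕ) + 1) * θ)) i) =
          (w m : ℂ) * Real.cos (θ + (2 * (j : ℕ) + 1) * θ) := by
      rw [← sub_neg_eq_add θ, ← sum_star_circlePoint hg hh hgh, Finset.mul_sum]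
      refine Finset.sum_congr rfl fun i _ => ?_
      rw [hcol]
      ring
    rw [h2, hcol]
    simp only [circlePoint]
    set α := (2 * (j : ℝ) + 1) * θ with hα
    have h3 : (2 * ((j + 1 : ℕ) : ℝ) + 1) * θ = θ + (θ + α) := by rw [hα]; push_cast; ring
    have h4 : Real.sin (θ + (θ + α)) = 2 * Real.cos (θ + α) * Real.sin θ + Real.sin α := by
      have : Real.sin α = Real.sin ((θ + α) - θ) := by congr 1; ring
      rw [this, Real.sin_add, Real.sin_sub]
      ring
    have h5 : Real.cos (θ + (θ + α)) = 2 * Real.cos (θ + α) * Real.cos θ - Real.cos α := by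
      have : Real.cos α = Real.cos ((θ + α) - θ) := by congr 1; ring
      rw [this, Real.cos_add, Real.cos_sub]
      ring
    rw [h3, h4, h5, Real.sin_neg, Real.cos_neg]
    push_cast
    ring
  -- Only the reflections are controlled by the counter. Where they are skipped, the inverse of the
  -- flagged oracle and the flagged oracle cancel.
  · simp only [hj, if_false, Matrix.mulVec_mulVec]
    rw [show min (m : ℕ) (j + 1) = min (m : ℕ) j by omega]
    have hU : (flaggedOracle O f : Matrix (Q × Bool) (Q × Bool) ℂ) *
        ((flaggedOracle O f)⁻¹ : Matrix.unitaryGroup (Q × Bool) ℂ).1 = 1 :=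
      (Matrix.mem_unitaryGroup_iff).1 (flaggedOracle O f).2
    rw [hU, Matrix.one_mulVec]

theorem amplitudeCircuit_state [NeZero M] (hM : 2 ≤ M) (O : Matrix.unitaryGroup Q ℂ) (z : Q)
    (f : Q → ℝ) {g h : Q × Bool → ℂ} {θ : ℝ} (hg : ∑ i, ‖g i‖ ^ 2 = 1)
    (hh : ∑ i, ‖h i‖ ^ 2 = 1) (hg0 : ∀ q, g (q, false) = 0) (hh0 : ∀ q, h (q, true) = 0)
    (hcol : ∀ i, (flaggedOracle O f : Matrix (Q × Bool) (Q × Bool) ℂ) i (z, false) =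
      circlePoint g h θ i) :
    runCircuit O (amplitudeCircuit M z f) (Pi.single (z, (false, (0 : Fin M))) 1) =
      blocks fun x i => (dftInv M : Matrix (Fin M) (Fin M) ℂ).mulVec
        (fun m => (window M m : ℂ) * circlePoint g h ((2 * (m : ℕ) + 1) * θ) i) x := by
  have hinit : (Pi.single (z, (false, (0 : Fin M))) 1 : Q × (Bool × Fin M) → ℂ) =
      blocks fun m i => (Pi.single (z, false) 1 : Q × Bool → ℂ) i *
        (Pi.single (0 : Fin M) 1 : Fin M → ℂ) m := by
    funext ⟨q, b, m⟩
    simp only [blocks, Pi.single_apply, Prod.mk.injEq]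
    split_ifs <;> simp_all
  have hprep : (unitaryWithCol (0 : Fin M) fun m => (window M m : ℂ) :
      Matrix (Fin M) (Fin M) ℂ).mulVec (Pi.single 0 1) = fun m : Fin M => (window M m : ℂ) := by
    funext m
    rw [Matrix.mulVec_single_one, Matrix.col_apply, unitaryWithCol_apply]
    rw [← sum_window_sq hM, ← Fin.sum_univ_eq_sum_range (fun m => window M m ^ 2)]
    simp
  have hstep (n : ℕ) : runCircuit O ((List.range n).flatMap (groverStep M z f))
      (blocks fun m i => (window M m : ℂ) * circlePoint g h θ i) =
        blocks fun m i =>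
          (window M m : ℂ) * circlePoint g h ((2 * (min m n : ℕ) + 1) * θ) i := by
    induction n with
    | zero => simp [runCircuit_nil]
    | succ n ih =>
      rw [List.range_succ, List.flatMap_append, runCircuit_append, ih, List.flatMap_singleton,
        groverStep_blocks O z f hg hh hg0 hh0 hcol]
  rw [amplitudeCircuit, runCircuit_cons, hinit, onCounter_blocks]
  have hinit' : (fun x i => (unitaryWithCol (0 : Fin M) fun m => (window M m : ℂ) :
      Matrix (Fin M) (Fin M) ℂ).mulVec (fun m => (Pi.single (z, false) 1 : Q × Bool → ℂ) i *
        (Pi.single (0 : Fin M) 1 : Fin M → ℂ) m) x) =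
      fun (m : Fin M) => (window M m : ℂ) • (Pi.single (z, false) 1 : Q × Bool → ℂ) := by
    funext m i
    have h1 : (fun m => (Pi.single (z, false) 1 : Q × Bool → ℂ) i *
        (Pi.single (0 : Fin M) 1 : Fin M → ℂ) m) =
          (Pi.single (z, false) 1 : Q × Bool → ℂ) i • (Pi.single (0 : Fin M) 1 : Fin M → ℂ) := rfl
    rw [h1, Matrix.mulVec_smul, hprep]
    simp [mul_comm]
  have hΨ (m : Fin M) : (flaggedOracle O f : Matrix (Q × Bool) (Q × Bool) ℂ).mulVec
      ((window M m : ℂ) • (Pi.single (z, false) 1 : Q × Bool → ℂ)) =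
        fun i => (window M m : ℂ) * circlePoint g h θ i := by
    funext i
    rw [Matrix.mulVec_smul, Matrix.mulVec_single_one, Pi.smul_apply, Matrix.col_apply, hcol,
      smul_eq_mul]
  rw [hinit', runCircuit_cons, query_blocks, runCircuit_cons, onFlagged_blocks]
  simp only [flaggedOracle_mulVec, hΨ]
  rw [runCircuit_append, hstep, runCircuit_cons, onCounter_blocks, runCircuit_nil]
  -- Every counter value is below `M`, so after `M` controlled steps the value `m` has received
  -- exactly `m` of them.
  simp only [min_eq_left (Fin.is_lt _).le]

theorem norm_sq_add_norm_sq (s c : ℂ) :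
    ‖s‖ ^ 2 + ‖c‖ ^ 2 = (‖c + Complex.I * s‖ ^ 2 + ‖c - Complex.I * s‖ ^ 2) / 2 := by
  have h := parallelogram_law_with_norm ℝ c (Complex.I * s)
  rw [norm_mul, Complex.norm_I, one_mul] at h
  linarith

/-- The distribution of the counter is an even mixture of phase estimations for `θ` and `-θ`. -/
theorem sum_amplitude_norm_sq {ι : Type} [Fintype ι] [NeZero M] (w : ℕ → ℝ) {g h : ι → ℂ} (θ : ℝ)
    (hg : ∑ i, ‖g i‖ ^ 2 = 1) (hh : ∑ i, ‖h i‖ ^ 2 = 1) (hgh : ∀ i, g i = 0 ∨ h i = 0)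
    (x : Fin M) :
    ∑ i, ‖(dftInv M : Matrix (Fin M) (Fin M) ℂ).mulVec
        (fun m => (w m : ℂ) * circlePoint g h ((2 * (m : ℕ) + 1) * θ) i) x‖ ^ 2 =
      (‖phaseAmp M w θ x‖ ^ 2 + ‖phaseAmp M w (-θ) x‖ ^ 2) / 2 := by
  set V := (dftInv M : Matrix (Fin M) (Fin M) ℂ) with hV
  set s := V.mulVec (fun m => (w m : ℂ) * Real.sin ((2 * (m : ℕ) + 1) * θ)) x with hs
  set c := V.mulVec (fun m => (w m : ℂ) * Real.cos ((2 * (m : ℕ) + 1) * θ)) x with hc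
  have h1 (i : ι) : V.mulVec
      (fun m => (w m : ℂ) * circlePoint g h ((2 * (m : ℕ) + 1) * θ) i) x = s * g i + c * h i := by
    simp only [hs, hc, Matrix.mulVec, dotProduct, Finset.sum_mul]
    rw [← Finset.sum_add_distrib]
    refine Finset.sum_congr rfl fun m _ => ?_
    simp only [circlePoint]
    ring
  have h2 (i : ι) : ‖s * g i + c * h i‖ ^ 2 = ‖s‖ ^ 2 * ‖g i‖ ^ 2 + ‖c‖ ^ 2 * ‖h i‖ ^ 2 := by
    rcases hgh i with h | h <;> simp [h, mul_pow]
  have h3 : phaseAmp M w θ x = c + Complex.I * s := by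
    simp only [phaseAmp, hs, hc, Matrix.mulVec, dotProduct, Finset.mul_sum]
    rw [← Finset.sum_add_distrib]
    refine Finset.sum_congr rfl fun m _ => ?_
    rw [mul_comm Complex.I ((2 * ((m : ℕ) : ℂ) + 1) * θ), Complex.exp_mul_I]
    push_cast
    ring
  have h4 : phaseAmp M w (-θ) x = c - Complex.I * s := by
    simp only [phaseAmp, hs, hc, Matrix.mulVec, dotProduct, Finset.mul_sum]
    rw [← Finset.sum_sub_distrib]
    refine Finset.sum_congr rfl fun m _ => ?_
    rw [mul_comm Complex.I, Complex.exp_mul_I]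
    push_cast
    rw [mul_neg, Complex.cos_neg, Complex.sin_neg]
    ring
  simp_rw [h1, h2]
  rw [Finset.sum_add_distrib, ← Finset.mul_sum, ← Finset.mul_sum, hg, hh, mul_one, mul_one, h3, h4,
    norm_sq_add_norm_sq]

/-- The flagged state in terms of unit vectors on which the flag is set and not set. -/
theorem exists_circlePoint (O : Matrix.unitaryGroup Q ℂ) (z : Q) {f : Q → ℝ}
    (hf : ∀ q, 0 ≤ f q ∧ f q ≤ 1) :
    ∃ (g h : Q × Bool → ℂ) (θ : ℝ), ∑ i, ‖g i‖ ^ 2 = 1 ∧ ∑ i, ‖h i‖ ^ 2 = 1 ∧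
      (∀ q, g (q, false) = 0) ∧ (∀ q, h (q, true) = 0) ∧
      Real.sin θ = Real.sqrt (∑ q, ‖(O : Matrix Q Q ℂ) q z‖ ^ 2 * f q) ∧
      ∀ i, (flaggedOracle O f : Matrix (Q × Bool) (Q × Bool) ℂ) i (z, false) =
        circlePoint g h θ i := by
  have : Nonempty Q := ⟨z⟩
  set a := ∑ q, ‖(O : Matrix Q Q ℂ) q z‖ ^ 2 * f q with ha
  have hcol : ∑ q, ‖(O : Matrix Q Q ℂ) q z‖ ^ 2 = 1 := by
    have h := sum_norm_sq_mulVec O (Pi.single z 1)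
    rw [Matrix.mulVec_single_one] at h
    simp only [Matrix.col_apply] at h
    rw [h, Finset.sum_eq_single z] <;> simp +contextual
  have ha0 : 0 ≤ a := Finset.sum_nonneg fun q _ => mul_nonneg (by positivity) (hf q).1
  have ha1 : a ≤ 1 := by
    rw [← hcol]
    exact Finset.sum_le_sum fun q _ => mul_le_of_le_one_right (by positivity) (hf q).2
  obtain ⟨g, hg, hgv⟩ := exists_unit_vector fun q =>
    (O : Matrix Q Q ℂ) q z * (Real.sqrt (f q) : ℂ)
  obtain ⟨h, hh, hhv⟩ := exists_unit_vector fun q =>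
    (O : Matrix Q Q ℂ) q z * (Real.sqrt (1 - f q) : ℂ)
  have e1 : ∑ q, ‖(O : Matrix Q Q ℂ) q z * (Real.sqrt (f q) : ℂ)‖ ^ 2 = a := by
    refine Finset.sum_congr rfl fun q _ => ?_
    rw [norm_mul, mul_pow, Complex.norm_real, Real.norm_eq_abs, sq_abs, Real.sq_sqrt (hf q).1]
  have e2 : ∑ q, ‖(O : Matrix Q Q ℂ) q z * (Real.sqrt (1 - f q) : ℂ)‖ ^ 2 = 1 - a := by
    have h1 : 1 - a = ∑ q, ‖(O : Matrix Q Q ℂ) q z‖ ^ 2 - a := by rw [hcol]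
    rw [h1, ha, ← Finset.sum_sub_distrib]
    refine Finset.sum_congr rfl fun q _ => ?_
    rw [norm_mul, mul_pow, Complex.norm_real, Real.norm_eq_abs, sq_abs,
      Real.sq_sqrt (sub_nonneg.2 (hf q).2)]
    ring
  have hsin : Real.sin (Real.arcsin (Real.sqrt a)) = Real.sqrt a :=
    Real.sin_arcsin (by linarith [Real.sqrt_nonneg a]) (Real.sqrt_le_one.2 ha1)
  refine ⟨fun i => if i.2 then g i.1 else 0, fun i => if i.2 then 0 else h i.1,
    Real.arcsin (Real.sqrt a), ?_, ?_, fun q => by simp, fun q => by simp, hsin, ?_⟩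
  · simpa [Fintype.sum_prod_type] using hg
  · simpa [Fintype.sum_prod_type] using hh
  · rintro ⟨q, b⟩
    rw [flaggedOracle_apply O hf]
    rw [e1] at hgv
    rw [e2] at hhv
    cases b
    · simp [circlePoint, hhv, Real.cos_arcsin, Real.sq_sqrt ha0]
    · simp [circlePoint, hgv, Real.sin_arcsin (by linarith [Real.sqrt_nonneg a])
        (Real.sqrt_le_one.2 ha1)]

/-- The difference factors as `-sin (θ - φ) sin (θ + φ)`, and the second factor is itself small when
`sin θ` is. This is the source of `√E[Y]` in the error. -/
theorem abs_sin_sq_sub_sin_sq_le {φ θ e : ℝ} (hθ : 0 ≤ Real.sin θ)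
    (h : |Real.sin (θ - φ)| ≤ e) :
    |Real.sin φ ^ 2 - Real.sin θ ^ 2| ≤ e * (2 * Real.sin θ) + e ^ 2 := by
  have h1 : Real.sin φ ^ 2 - Real.sin θ ^ 2 = -(Real.sin (θ - φ) * Real.sin (θ + φ)) := by
    rw [Real.sin_sub, Real.sin_add]
    linear_combination Real.sin θ ^ 2 * Real.sin_sq_add_cos_sq φ -
      Real.sin φ ^ 2 * Real.sin_sq_add_cos_sq θ
  have h2 : |Real.sin (θ + φ)| ≤ 2 * Real.sin θ + e := by
    have h3 : Real.sin (θ + φ) = 2 * Real.sin θ * (Real.cos θ * Real.cos (θ - φ))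
        - Real.cos (2 * θ) * Real.sin (θ - φ) := by
      have : θ + φ = 2 * θ - (θ - φ) := by ring
      rw [this, Real.sin_sub, Real.sin_two_mul]
      ring
    rw [h3]
    refine (abs_sub _ _).trans (add_le_add ?_ ?_)
    · rw [abs_mul, abs_of_nonneg (by linarith), abs_mul]
      exact mul_le_of_le_one_right (by linarith)
        (mul_le_one₀ (Real.abs_cos_le_one _) (abs_nonneg _) (Real.abs_cos_le_one _))
    · rw [abs_mul]
      exact (mul_le_of_le_one_left (abs_nonneg _) (Real.abs_cos_le_one _)).trans h
  rw [h1, abs_neg, abs_mul]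
  calc _ ≤ e * (2 * Real.sin θ + e) :=
        mul_le_mul h h2 (abs_nonneg _) ((abs_nonneg _).trans h)
    _ = _ := by ring

open Classical in
/-- Chebyshev's inequality for phase estimation with the sine window. -/
theorem sum_phaseAmp_far_le [NeZero M] (hM : 2 ≤ M) (θ : ℝ) :
    ∑ x : Fin M, (if 4 / M < |Real.sin (θ - Real.pi * x / M)| then
      ‖phaseAmp M (window M) θ x‖ ^ 2 else 0) ≤ 1 / 6 := by
  have hM0 : (0 : ℝ) < M := by exact_mod_cast (by omega : 0 < M)
  have h1 := (sum_phaseAmp_sin_sq M (window_zero M) (window_self M (by omega)) θ).trans_le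
    (sum_window_sub_sq_le hM)
  -- The threshold `4/M` makes the bound `(π/M)² / (8/M)² = π²/64`, which is below `1/6`.
  have h2 : ∑ x : Fin M, (8 / M : ℝ) ^ 2 * (if 4 / M < |Real.sin (θ - Real.pi * x / M)| then
      ‖phaseAmp M (window M) θ x‖ ^ 2 else 0) ≤ (Real.pi / M) ^ 2 := by
    refine (Finset.sum_le_sum fun x _ => ?_).trans h1
    split_ifs with hx
    · rw [mul_comm]
      gcongr ?_ * ?_
      rw [← sq_abs (2 * _), abs_mul, abs_two]
      gcongr
      calc (8 / M : ℝ) = 2 * (4 / M) := by ring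
        _ ≤ _ := by gcongr
    · rw [mul_zero]
      positivity
  rw [← Finset.mul_sum, div_pow, div_pow, div_mul_eq_mul_div, div_le_div_iff_of_pos_right
    (by positivity)] at h2
  nlinarith [Real.pi_lt_d2, Real.pi_pos]

theorem amplitudeEstimate_law_le [NeZero M] (hM : 2 ≤ M) (O : Matrix.unitaryGroup Q ℂ) (z : Q)
    {f : Q → ℝ} (hf : ∀ q, 0 ≤ f q ∧ f q ≤ 1) {a : ℝ}
    (ha : ∑ q, ‖(O : Matrix Q Q ℂ) q z‖ ^ 2 * f q = a) {r : ℝ}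
    (hr : 4 / M * (2 * Real.sqrt a) + (4 / M) ^ 2 ≤ r) :
    ((amplitudeEstimate M z f).law O).toOuterMeasure (Set.Icc (a - r) (a + r))ᶜ ≤
      ENNReal.ofReal (1 / 6) := by
  classical
  obtain ⟨g, h, θ, hg, hh, hg0, hh0, hsin, hcol⟩ := exists_circlePoint O z hf
  rw [ha] at hsin
  have ha0 : 0 ≤ a := ha ▸ Finset.sum_nonneg fun q _ => mul_nonneg (by positivity) (hf q).1
  have hgh : ∀ i, g i = 0 ∨ h i = 0 := by
    rintro ⟨q, b⟩
    cases b
    · exact Or.inl (hg0 q)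
    · exact Or.inr (hh0 q)
  have hgood (x : Fin M) (φ : ℝ) (hφ : Real.sin φ ^ 2 = Real.sin (Real.pi * x / M) ^ 2)
      (hx : |Real.sin (θ - φ)| ≤ 4 / M) :
      Real.sin (Real.pi * x / M) ^ 2 ∈ Set.Icc (a - r) (a + r) := by
    have h1 := (abs_sin_sq_sub_sin_sq_le (hsin ▸ Real.sqrt_nonneg a) hx).trans (hsin ▸ hr)
    rw [hφ, hsin, Real.sq_sqrt ha0, abs_le] at h1
    constructor <;> linarith
  -- The output is even in the phase, so an outcome near `θ` or near `-θ` is good. A bad one is thus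
  -- in the tail of both components of the mixture.
  have hbad (x : Fin M) (hx : Real.sin (Real.pi * x / M) ^ 2 ∉ Set.Icc (a - r) (a + r)) :
      4 / M < |Real.sin (θ - Real.pi * x / M)| ∧ 4 / M < |Real.sin (-θ - Real.pi * x / M)| := by
    constructor
    · by_contra! hc
      exact hx (hgood x _ rfl hc)
    · by_contra! hc
      refine hx (hgood x (-(Real.pi * x / M)) (by simp) ?_)
      rwa [← abs_neg, ← Real.sin_neg, show -(θ - -(Real.pi * x / M)) = -θ - Real.pi * x / M by ring]
  rw [amplitudeEstimate, QAlg.law, PMF.toOuterMeasure_bind_apply, tsum_fintype]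
  have h1 (b : Q × Bool × Fin M) :
      measure O (z, false, (0 : Fin M)) (amplitudeCircuit M z f) b *
        (QAlg.law O (.output (Real.sin (Real.pi * b.2.2 / M) ^ 2))).toOuterMeasure
          (Set.Icc (a - r) (a + r))ᶜ ≤
      ENNReal.ofReal (if Real.sin (Real.pi * b.2.2 / M) ^ 2 ∉ Set.Icc (a - r) (a + r) then
        ‖(dftInv M : Matrix (Fin M) (Fin M) ℂ).mulVec (fun m => (window M m : ℂ) *
          circlePoint g h ((2 * (m : ℕ) + 1) * θ) (b.1, b.2.1)) b.2.2‖ ^ 2 else 0) := by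
    rw [QAlg.law]
    split_ifs with hb
    · rw [toOuterMeasure_pure_of_notMem (Set.notMem_compl_iff.2 hb)]
      simp
    · refine mul_le_of_le_one_right' ?_ |>.trans ?_
      · rw [PMF.toOuterMeasure_pure_apply]
        split_ifs <;> simp
      · rw [measure_apply, amplitudeCircuit_state hM O z f hg hh hg0 hh0 hcol]
        rfl
  refine (Finset.sum_le_sum fun b _ => h1 b).trans ?_
  rw [← ENNReal.ofReal_sum_of_nonneg fun b _ => by split_ifs <;> positivity]
  refine ENNReal.ofReal_le_ofReal ?_
  rw [← (Equiv.prodAssoc Q Bool (Fin M)).sum_comp, Fintype.sum_prod_type_right]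
  simp only [Equiv.prodAssoc_apply]
  calc _ ≤ ∑ x : Fin M, ((if 4 / M < |Real.sin (θ - Real.pi * x / M)| then
              ‖phaseAmp M (window M) θ x‖ ^ 2 else 0) +
            (if 4 / M < |Real.sin (-θ - Real.pi * x / M)| then
              ‖phaseAmp M (window M) (-θ) x‖ ^ 2 else 0)) / 2 := by
        refine Finset.sum_le_sum fun x _ => ?_
        by_cases hx : Real.sin (Real.pi * x / M) ^ 2 ∈ Set.Icc (a - r) (a + r)
        · simp only [hx, not_true_eq_false, if_false, Finset.sum_const_zero]
          positivity
        · simp only [hx, not_false_eq_true, if_true, (hbad x hx).1, (hbad x hx).2]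
          rw [← sum_amplitude_norm_sq (window M) θ hg hh hgh x]
    _ ≤ 1 / 6 := by
        rw [← Finset.sum_div, Finset.sum_add_distrib]
        linarith [sum_phaseAmp_far_le hM θ, sum_phaseAmp_far_le hM (-θ)]

end AmplitudeEstimation

/-! ### A quantum Monte Carlo mean estimator -/

/-- Medians of amplitude estimates, or `0` if the time parameter is too small. -/
def medianEstimator : EstimatorFamily := fun _ _ _ _ _ _ z f t δ =>
  if t < Real.log (1 / δ) then .output 0
  else QAlg.medianRuns
    (amplitudeEstimate (⌊t / Real.log (1 / δ)⌋₊ + 2) z fun q => f q.1) ⌈4 * Real.log (1 / δ)⌉₊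

theorem Encodes.sum_eq {L W : Type} [Fintype L] [DecidableEq L] [Fintype W] [DecidableEq W]
    {O : Matrix.unitaryGroup (L × W) ℂ} {z : L × W} {p : L → ℝ} (hp : ∀ l, 0 ≤ p l)
    (h : Encodes O z p) (f : L → ℝ) :
    ∑ q : L × W, ‖(O : Matrix (L × W) (L × W) ℂ) q z‖ ^ 2 * f q.1 = ∑ l, p l * f l := by
  obtain ⟨ψ, hψ, hO⟩ := h
  rw [Fintype.sum_prod_type]
  refine Finset.sum_congr rfl fun l _ => ?_
  simp only [hO, norm_mul, mul_pow, Complex.norm_real, Real.norm_eq_abs, sq_abs,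
    Real.sq_sqrt (hp l)]
  rw [← Finset.sum_mul, ← Finset.mul_sum, hψ, mul_one]

theorem Encodes.sum_eq_one {L W : Type} [Fintype L] [DecidableEq L] [Fintype W] [DecidableEq W]
    {O : Matrix.unitaryGroup (L × W) ℂ} {z : L × W} {p : L → ℝ} (hp : ∀ l, 0 ≤ p l)
    (h : Encodes O z p) : ∑ l, p l = 1 := by
  have h1 := h.sum_eq hp fun _ => 1
  have h2 := sum_norm_sq_mulVec O (Pi.single z 1)
  rw [Matrix.mulVec_single_one] at h2
  simp only [Matrix.col_apply] at h2
  simp only [mul_one] at h1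
  rw [← h1, h2, Finset.sum_eq_single z] <;> simp +contextual

/-- If `t < log(1/δ)`, the permitted error exceeds `1` and the output `0` suffices. Otherwise `M =
⌊t / log(1/δ)⌋ + 2` is at least `2`, as the window requires, and exceeds `t / log(1/δ)`. -/
theorem isQME_medianEstimator : IsQME medianEstimator := by
  -- `16` is the square of the constant in the phase error `4/M`. `48 = 6 · 8`: at most `6 log(1/δ)`
  -- runs, each with at most `8 t / log(1/δ)` queries.
  refine ⟨16, 48, ?_⟩
  intro L W _ _ _ _ z f t δ hf ht hδ hδ2
  have ht0 : (0 : ℝ) < t := by exact_mod_cast ht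
  have hl2 : (1 / 2 : ℝ) ≤ Real.log (1 / δ) := by
    have h1 : (2 : ℝ) ≤ 1 / δ := by rw [le_div_iff₀ hδ]; linarith
    have h2 := Real.log_le_log (by norm_num) h1
    linarith [Real.log_two_gt_d9]
  set l := Real.log (1 / δ) with hl
  have hl0 : 0 < l := by linarith
  have hceil : (⌈4 * l⌉₊ : ℝ) ≤ 6 * l := by
    have := Nat.ceil_lt_add_one (a := 4 * l) (by positivity)
    linarith
  simp only [medianEstimator, ← hl]
  split_ifs with htl
  · refine ⟨by simp [QAlg.queries, ht0.le], fun O p hp hO => ?_⟩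
    rw [one_sub_le_toMeasure_iff _ (measurableSet_le (by fun_prop) (by fun_prop)) hδ.le, QAlg.law,
      toOuterMeasure_pure_of_notMem]
    · simp
    · have h0 : 0 ≤ ∑ y, p y * f y := Finset.sum_nonneg fun y _ => mul_nonneg (hp y) (hf y).1
      have h1 : ∑ y, p y * f y ≤ 1 := by
        rw [← hO.sum_eq_one hp]
        exact Finset.sum_le_sum fun y _ => mul_le_of_le_one_right (hp y) (hf y).2
      have h2 : 1 ≤ l ^ 2 / (t : ℝ) ^ 2 := by
        rw [← div_pow]
        exact one_le_pow₀ ((one_le_div ht0).2 htl.le)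
      have h3 : 0 ≤ Real.sqrt (∑ y, p y * f y) * l / t := by positivity
      rw [Set.notMem_compl_iff, Set.mem_ofPred_eq, zero_sub, abs_neg, abs_of_nonneg h0]
      linarith
  · rw [not_lt] at htl
    set N := ⌊t / l⌋₊ with hN
    have hNle : (N : ℝ) ≤ t / l := Nat.floor_le (by positivity)
    have hNlt : t / l < N + 1 := Nat.lt_floor_add_one _
    constructor
    · calc ((QAlg.medianRuns (amplitudeEstimate (N + 2) z fun q => f q.1) ⌈4 * l⌉₊).queries : ℝ)
          ≤ ((⌈4 * l⌉₊ * (2 * (N + 2) + 1) : ℕ) : ℝ) := by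
            exact_mod_cast (QAlg.medianRuns_queries_le _ _).trans
              (Nat.mul_le_mul_left _ (amplitudeEstimate_queries _ _ _))
        _ ≤ 6 * l * (8 * (t / l)) := by
            push_cast
            have h1 : 1 ≤ t / l := (one_le_div hl0).2 htl
            gcongr
            linarith
        _ = 48 * t := by field_simp; ring
    · intro O p hp hO
      rw [one_sub_le_toMeasure_iff _ (measurableSet_le (by fun_prop) (by fun_prop)) hδ.le]
      set a := ∑ y, p y * f y with ha
      set r := 16 * (Real.sqrt a * l / t + l ^ 2 / (t : ℝ) ^ 2) with hr
      have hset : {x | |x - a| ≤ r} = Set.Icc (a - r) (a + r) := by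
        ext x
        rw [Set.mem_ofPred_eq, abs_le, Set.mem_Icc]
        constructor <;> rintro ⟨h1, h2⟩ <;> constructor <;> linarith
      rw [hset]
      have hinv : (4 / (N + 2 : ℕ) : ℝ) ≤ 4 * (l / t) := by
        rw [show 4 * (l / t) = 4 / (t / l) by field_simp]
        gcongr
        push_cast
        linarith
      refine (QAlg.medianRuns_law_le O _ _ (amplitudeEstimate_law_le (by omega) O z
        (fun q => hf q.1) (hO.sum_eq hp f) ?_)).trans (ENNReal.ofReal_le_ofReal ?_)
      · calc (4 / (N + 2 : ℕ) : ℝ) * (2 * Real.sqrt a) + (4 / (N + 2 : ℕ)) ^ 2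
            ≤ 4 * (l / t) * (2 * Real.sqrt a) + (4 * (l / t)) ^ 2 := by gcongr
          _ = 8 * (Real.sqrt a * l / t) + 16 * (l ^ 2 / t ^ 2) := by ring
          _ ≤ r := by
            have : 0 ≤ Real.sqrt a * l / t := by positivity
            rw [hr]
            linarith
      -- Since `3/4 ≤ exp(-1/4)`, `4 log(1/δ)` repetitions are enough.
      · calc ((3 / 4 : ℝ)) ^ ⌈4 * l⌉₊ ≤ Real.exp (-(1 / 4)) ^ ⌈4 * l⌉₊ := by
              gcongr
              linarith [Real.add_one_le_exp (-(1 / 4) : ℝ)]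
          _ = Real.exp (-(⌈4 * l⌉₊ / 4)) := by
              rw [← Real.exp_nat_mul]
              congr 1
              ring
          _ ≤ Real.exp (-l) := by
              gcongr
              linarith [Nat.le_ceil (4 * l)]
          _ = δ := by
              rw [hl, one_div, Real.log_inv, neg_neg, Real.exp_log hδ]

/-! ### The truncated mean estimator -/

section Grid

variable {n : ℕ} {B : ℝ}

theorem grid_pos (hn : 1 ≤ n) (hB : 0 < B) (l : ℕ) : 0 < grid n B l := by
  have : (0 : ℝ) < n := by exact_mod_cast hn
  exact lt_min (by positivity) hB

theorem grid_le (l : ℕ) : grid n B l ≤ B := min_le_right _ _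

theorem grid_le_succ (hB : 0 < B) (l : ℕ) : grid n B l ≤ grid n B (l + 1) := by
  refine min_le_min_right _ ?_
  gcongr
  · norm_num
  · exact l.le_succ

theorem grid_succ_le (hB : 0 < B) (l : ℕ) : grid n B (l + 1) ≤ 2 * grid n B l := by
  rw [grid, grid, mul_min_of_nonneg _ _ (by norm_num)]
  refine min_le_min (le_of_eq ?_) (by linarith)
  rw [pow_succ]
  ring

theorem grid_lastIndex (hn : 1 ≤ n) (hB : 0 < B) : grid n B (lastIndex n) = B := by
  have hn0 : (0 : ℝ) < n := by exact_mod_cast hn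
  refine min_eq_right ?_
  have h : (n : ℝ) ≤ 2 ^ lastIndex n := by exact_mod_cast Nat.le_pow_clog (by norm_num) n
  exact le_mul_of_one_le_left hB.le ((one_le_div hn0).2 h)

/-- The half-open segments partition `[0, a_m)`. Those above the cap are empty. -/
theorem sum_segments (hB : 0 < B) {y : ℝ} (hy : 0 ≤ y) (a : ℝ) (m : ℕ) :
    ∑ l ∈ Finset.range (m + 1), (if gridLeft n B l ≤ y ∧ y < grid n B l then a else 0) =
      if y < grid n B m then a else 0 := by
  induction m with
  | zero => simp [gridLeft, hy]
  | succ m ih =>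
    rw [Finset.sum_range_succ, ih, gridLeft]
    have := grid_le_succ (n := n) hB m
    by_cases h1 : y < grid n B m
    · simp [h1, h1.trans_le this, not_le.2 h1]
    · simp [h1, not_lt.1 h1]

/-- The end points of a segment differ by a factor of at most two, except near zero. -/
theorem grid_mul_le (hn : 1 ≤ n) (hB : 0 < B) {y : ℝ} (hy : 0 ≤ y) {l : ℕ}
    (h : gridLeft n B l ≤ y ∧ y < grid n B l) :
    grid n B l * y ≤ 2 * y ^ 2 + (B / n) ^ 2 := by
  cases l with
  | zero =>
    have h1 : grid n B 0 ≤ B / n := (min_le_left _ _).trans (le_of_eq (by ring))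
    have h2 := grid_pos hn hB 0
    have := h.2
    nlinarith [sq_nonneg y]
  | succ l =>
    have h1 := grid_succ_le (n := n) hB l
    have h2 : grid n B l ≤ y := h.1
    nlinarith [sq_nonneg (B / n)]

end Grid

/-! ### Truncated moments and the error summed over the segments. -/

section Segments

variable {L : Type} [Fintype L] {p Y : L → ℝ} {n : ℕ} {B : ℝ}

/-- The scaled mean of the part of `Y` in the `l`-th segment. -/
def segmentMean (p Y : L → ℝ) (n : ℕ) (B : ℝ) (l : ℕ) : ℝ :=
  ∑ y, p y * (if gridLeft n B l ≤ Y y ∧ Y y < grid n B l then Y y / grid n B l else 0)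

theorem grid_mul_segmentMean (hn : 1 ≤ n) (hB : 0 < B) (l : ℕ) :
    grid n B l * segmentMean p Y n B l =
      ∑ y, p y * (if gridLeft n B l ≤ Y y ∧ Y y < grid n B l then Y y else 0) := by
  have := grid_pos hn hB l
  rw [segmentMean, Finset.mul_sum]
  refine Finset.sum_congr rfl fun y _ => ?_
  split_ifs
  · field_simp
  · simp

theorem segmentMean_nonneg (hp : ∀ y, 0 ≤ p y) (hY : ∀ y, 0 ≤ Y y) (hn : 1 ≤ n) (hB : 0 < B)
    (l : ℕ) : 0 ≤ segmentMean p Y n B l := by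
  refine Finset.sum_nonneg fun y _ => mul_nonneg (hp y) ?_
  split_ifs
  · exact div_nonneg (hY y) (grid_pos hn hB l).le
  · exact le_rfl

theorem sum_grid_mul_segmentMean (hY : ∀ y, 0 ≤ Y y) (hn : 1 ≤ n) (hB : 0 < B) :
    ∑ l ∈ Finset.range (lastIndex n + 1), grid n B l * segmentMean p Y n B l =
      ∑ y, p y * (if Y y < B then Y y else 0) := by
  simp_rw [grid_mul_segmentMean hn hB]
  rw [Finset.sum_comm]
  refine Finset.sum_congr rfl fun y _ => ?_
  rw [← Finset.mul_sum, sum_segments hB (hY y), grid_lastIndex hn hB]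

/-- One factor `a_ℓ` cancels the scaling of the segment mean. The other is compared with `Y` by
`grid_mul_le`; only the lowest segment, where `Y` may be much smaller than `a_0`, needs the term
`(B/n)²`. -/
theorem sum_grid_sq_mul_segmentMean_le (hp : ∀ y, 0 ≤ p y) (hp1 : ∑ y, p y = 1)
    (hY : ∀ y, 0 ≤ Y y) (hn : 1 ≤ n) (hB : 0 < B) :
    ∑ l ∈ Finset.range (lastIndex n + 1), grid n B l ^ 2 * segmentMean p Y n B l ≤
      2 * ∑ y, p y * (if Y y < B then Y y ^ 2 else 0) + (B / n) ^ 2 := by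
  calc ∑ l ∈ Finset.range (lastIndex n + 1), grid n B l ^ 2 * segmentMean p Y n B l
      ≤ ∑ l ∈ Finset.range (lastIndex n + 1), ∑ y, p y *
          (if gridLeft n B l ≤ Y y ∧ Y y < grid n B l then 2 * Y y ^ 2 + (B / n) ^ 2 else 0) := by
        refine Finset.sum_le_sum fun l _ => ?_
        rw [pow_two, mul_assoc, grid_mul_segmentMean hn hB, Finset.mul_sum]
        refine Finset.sum_le_sum fun y _ => ?_
        rw [mul_left_comm]
        refine mul_le_mul_of_nonneg_left ?_ (hp y)
        split_ifs with h
        · exact grid_mul_le hn hB (hY y) h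
        · simp
    _ = ∑ y, p y * (if Y y < B then 2 * Y y ^ 2 + (B / n) ^ 2 else 0) := by
        rw [Finset.sum_comm]
        refine Finset.sum_congr rfl fun y _ => ?_
        rw [← Finset.mul_sum, sum_segments hB (hY y), grid_lastIndex hn hB]
    _ ≤ ∑ y, (2 * (p y * (if Y y < B then Y y ^ 2 else 0)) + p y * (B / n) ^ 2) := by
        refine Finset.sum_le_sum fun y _ => ?_
        have h1 : 0 ≤ p y * (B / n) ^ 2 := mul_nonneg (hp y) (sq_nonneg _)
        split_ifs
        · linarith
        · linarith
    _ = _ := by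
        rw [Finset.sum_add_distrib, ← Finset.mul_sum, ← Finset.sum_mul, hp1, one_mul]

/-- Cauchy–Schwarz over the `k + 1` segments. -/
theorem sum_grid_mul_sqrt_segmentMean_le (hp : ∀ y, 0 ≤ p y) (hp1 : ∑ y, p y = 1)
    (hY : ∀ y, 0 ≤ Y y) (hn : 1 ≤ n) (hB : 0 < B) :
    ∑ l ∈ Finset.range (lastIndex n + 1), grid n B l * Real.sqrt (segmentMean p Y n B l) ≤
      Real.sqrt (lastIndex n + 1) *
        Real.sqrt (2 * ∑ y, p y * (if Y y < B then Y y ^ 2 else 0) + (B / n) ^ 2) := by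
  rw [← Real.sqrt_mul (by positivity)]
  refine Real.le_sqrt_of_sq_le ((sq_sum_le_card_mul_sum_sq ..).trans ?_)
  rw [Finset.card_range, Nat.cast_succ]
  refine mul_le_mul_of_nonneg_left ?_ (by positivity)
  refine le_trans (le_of_eq ?_) (sum_grid_sq_mul_segmentMean_le hp hp1 hY hn hB)
  refine Finset.sum_congr rfl fun l _ => ?_
  rw [mul_pow, Real.sq_sqrt (segmentMean_nonneg hp hY hn hB l)]

/-- Below the level `B`, `Y² = Y^(1-v) Y^(1+v) ≤ B^(1-v) Y^(1+v)`, where `v ≤ 1` makes the power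
monotone. -/
theorem sum_truncated_sq_le (hp : ∀ y, 0 ≤ p y) (hY : ∀ y, 0 ≤ Y y) (hB : 0 < B) {v ρ : ℝ}
    (hv : 0 < v) (hv1 : v ≤ 1) (hu : ∑ y, p y * Y y ^ (1 + v) ≤ B ^ (1 + v) * ρ ^ 2) :
    ∑ y, p y * (if Y y < B then Y y ^ 2 else 0) ≤ (B * ρ) ^ 2 := by
  calc _ ≤ ∑ y, B ^ (1 - v) * (p y * Y y ^ (1 + v)) := by
        refine Finset.sum_le_sum fun y _ => ?_
        rw [mul_left_comm]
        refine mul_le_mul_of_nonneg_left ?_ (hp y)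
        have h0 := hY y
        split_ifs with h
        · calc Y y ^ 2 = Y y ^ (1 - v) * Y y ^ (1 + v) := by
                rw [← Real.rpow_add_of_nonneg h0 (by linarith) (by linarith),
                  show 1 - v + (1 + v) = (2 : ℕ) by push_cast; ring, Real.rpow_natCast]
            _ ≤ _ := by
                gcongr
        · positivity
    _ ≤ B ^ (1 - v) * (B ^ (1 + v) * ρ ^ 2) := by
        rw [← Finset.mul_sum]
        gcongr
    _ = (B * ρ) ^ 2 := by
        rw [← mul_assoc, ← Real.rpow_add hB, show 1 - v + (1 + v) = (2 : ℕ) by push_cast; ring,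
          Real.rpow_natCast, mul_pow]

/-- Above the level `B`, `Y = Y^(-v) Y^(1+v) ≤ B^(-v) Y^(1+v)`. -/
theorem abs_sum_truncated_sub_le (hp : ∀ y, 0 ≤ p y) (hY : ∀ y, 0 ≤ Y y) (hB : 0 < B) {v ρ : ℝ}
    (hv : 0 < v) (hu : ∑ y, p y * Y y ^ (1 + v) ≤ B ^ (1 + v) * ρ ^ 2) :
    |∑ y, p y * (if Y y < B then Y y else 0) - ∑ y, p y * Y y| ≤ B * ρ ^ 2 := by
  rw [← Finset.sum_sub_distrib]
  refine (Finset.abs_sum_le_sum_abs ..).trans ?_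
  calc _ ≤ ∑ y, B ^ (-v) * (p y * Y y ^ (1 + v)) := by
        refine Finset.sum_le_sum fun y _ => ?_
        have h0 := hY y
        have hpy := hp y
        rw [← mul_sub, abs_mul, abs_of_nonneg hpy, mul_left_comm]
        refine mul_le_mul_of_nonneg_left ?_ hpy
        split_ifs with h
        · rw [sub_self, abs_zero]
          positivity
        · rw [zero_sub, abs_neg, abs_of_nonneg h0]
          have hYB : B ≤ Y y := not_lt.1 h
          have hY0 : 0 < Y y := hB.trans_le hYB
          calc Y y = Y y ^ (-v) * Y y ^ (1 + v) := by
                rw [← Real.rpow_add hY0, show -v + (1 + v) = 1 by ring, Real.rpow_one]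
            _ ≤ _ := mul_le_mul_of_nonneg_right
                (Real.rpow_le_rpow_of_nonpos hB hYB (neg_nonpos.2 hv.le)) (by positivity)
    _ ≤ B ^ (-v) * (B ^ (1 + v) * ρ ^ 2) := by
        rw [← Finset.mul_sum]
        gcongr
    _ = B * ρ ^ 2 := by
        rw [← mul_assoc, ← Real.rpow_add hB, show -v + (1 + v) = 1 by ring, Real.rpow_one]

/-- The total error of the segments, when the ratio `s` of the logarithmic factor and the time
parameter of the calls is small enough. -/
theorem sum_call_error_le (hp : ∀ y, 0 ≤ p y) (hp1 : ∑ y, p y = 1) (hY : ∀ y, 0 ≤ Y y)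
    (hn : 1 ≤ n) (hB : 0 < B) {v ρ b c s : ℝ} (hv : 0 < v) (hv1 : v ≤ 1) (hρ : 0 < ρ) (hc : 0 < c)
    (hb : 0 ≤ b) (hnρ : 1 / n ≤ b * ρ) (hs : 0 ≤ s) (hsρ : c * Real.sqrt (lastIndex n + 1) * s ≤ ρ)
    (hu : ∑ y, p y * Y y ^ (1 + v) ≤ B ^ (1 + v) * ρ ^ 2) :
    ∑ l ∈ Finset.range (lastIndex n + 1),
        grid n B l * (Real.sqrt (segmentMean p Y n B l) * s + s ^ 2) ≤
      ((2 + b) / c + 1 / c ^ 2) * (B * ρ ^ 2) := by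
  have hk : (0 : ℝ) < lastIndex n + 1 := by positivity
  -- The constant `b` converts the grid resolution `1/n` into a multiple of `ρ`, and `2 + b²` is at
  -- most `(2 + b)²`.
  have hroot : Real.sqrt (2 * ∑ y, p y * (if Y y < B then Y y ^ 2 else 0) + (B / n) ^ 2) ≤
      (2 + b) * (B * ρ) := by
    refine Real.sqrt_le_iff.2 ⟨by positivity, ?_⟩
    have h1 := sum_truncated_sq_le hp hY hB hv hv1 hu
    have h2 : B / n ≤ b * (B * ρ) := by
      calc B / n = B * (1 / n) := by ring
        _ ≤ B * (b * ρ) := by gcongr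
        _ = _ := by ring
    have h3 : (B / n) ^ 2 ≤ (b * (B * ρ)) ^ 2 := by gcongr
    nlinarith [mul_nonneg hb (sq_nonneg (B * ρ))]
  have h1 : ∑ l ∈ Finset.range (lastIndex n + 1),
      grid n B l * (Real.sqrt (segmentMean p Y n B l) * s + s ^ 2) =
        (∑ l ∈ Finset.range (lastIndex n + 1),
          grid n B l * Real.sqrt (segmentMean p Y n B l)) * s +
        (∑ l ∈ Finset.range (lastIndex n + 1), grid n B l) * s ^ 2 := by
    rw [Finset.sum_mul, Finset.sum_mul, ← Finset.sum_add_distrib]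
    exact Finset.sum_congr rfl fun l _ => by ring
  have h2 : ∑ l ∈ Finset.range (lastIndex n + 1), grid n B l ≤ (lastIndex n + 1) * B := by
    refine (Finset.sum_le_card_nsmul _ _ B fun l _ => grid_le l).trans (le_of_eq ?_)
    simp
  have h3 : Real.sqrt (lastIndex n + 1) * s ≤ ρ / c := by
    rw [le_div_iff₀ hc]
    linarith
  rw [h1]
  calc _ ≤ Real.sqrt (lastIndex n + 1) * ((2 + b) * (B * ρ)) * s +
          (lastIndex n + 1) * B * s ^ 2 := by
        gcongr
        exact (sum_grid_mul_sqrt_segmentMean_le hp hp1 hY hn hB).trans (by gcongr)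
    _ = (2 + b) * (B * ρ) * (Real.sqrt (lastIndex n + 1) * s) +
          B * (Real.sqrt (lastIndex n + 1) * s) ^ 2 := by
        rw [mul_pow, Real.sq_sqrt hk.le]
        ring
    _ ≤ (2 + b) * (B * ρ) * (ρ / c) + B * (ρ / c) ^ 2 := by gcongr
    _ = _ := by field_simp

end Segments

/-! ### Parameters, query count and failure probability of the estimator. -/

section Estimator

variable {L W : Type} [Fintype L] [DecidableEq L] [Fintype W] [DecidableEq W]

theorem callFailure_pos {n : ℕ} {δ : ℝ} (hδ : 0 < δ) : 0 < callFailure n δ := by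
  rw [callFailure]
  positivity

theorem callFailure_le {n : ℕ} {δ : ℝ} (hδ : 0 < δ) : callFailure n δ ≤ δ / 2 := by
  rw [callFailure]
  gcongr
  linarith [(Nat.cast_nonneg (lastIndex n) : (0 : ℝ) ≤ _)]

theorem log_callFailure {n : ℕ} {δ : ℝ} (hδ : 0 < δ) :
    Real.log (1 / callFailure n δ) = Real.log (1 / δ) + Real.log (2 * (lastIndex n + 1)) := by
  rw [← Real.log_mul (by positivity) (by positivity), callFailure]
  congr 1
  field_simp

theorem log_callFailure_pos {n : ℕ} {δ : ℝ} (hδ : 0 < δ) (hδ1 : δ < 1) :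
    0 < Real.log (1 / callFailure n δ) := by
  refine Real.log_pos ((one_lt_div (callFailure_pos hδ)).2 ?_)
  linarith [callFailure_le (n := n) hδ]

theorem callTime_pos {n : ℕ} {c δ : ℝ} (hn : 1 ≤ n) (hc : 0 < c) (hδ : 0 < δ) (hδ1 : δ < 1) :
    1 ≤ callTime n c δ := by
  have h1 := log_callFailure_pos (n := n) hδ hδ1
  have h2 : 0 < Real.log (1 / δ) := Real.log_pos ((one_lt_div hδ).2 hδ1)
  have hn0 : (0 : ℝ) < n := by exact_mod_cast hn
  exact Nat.one_le_iff_ne_zero.2 (Nat.ceil_pos.2 (by positivity)).ne'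

/-- This explains the form of the time parameter: its quotient of logarithms trades `δ'` for `δ`,
and its factor `√(k+1)` pays for Cauchy–Schwarz. -/
theorem callTime_ratio_le {n : ℕ} {c δ : ℝ} (hn : 1 ≤ n) (hc : 0 < c) (hδ : 0 < δ)
    (hδ1 : δ < 1) :
    c * Real.sqrt (lastIndex n + 1) * (Real.log (1 / callFailure n δ) / callTime n c δ) ≤
      Real.log (1 / δ) / n := by
  have h1 := log_callFailure_pos (n := n) hδ hδ1
  have h2 : 0 < Real.log (1 / δ) := Real.log_pos ((one_lt_div hδ).2 hδ1)
  have hn0 : (0 : ℝ) < n := by exact_mod_cast hn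
  have ht : (0 : ℝ) < callTime n c δ := by exact_mod_cast callTime_pos hn hc hδ hδ1
  have h3 : c * n * Real.sqrt (lastIndex n + 1) *
      (Real.log (1 / callFailure n δ) / Real.log (1 / δ)) ≤ callTime n c δ := Nat.le_ceil _
  rw [← mul_div_assoc, div_le_div_iff₀ ht hn0]
  rw [← mul_div_assoc, div_le_iff₀ h2] at h3
  linarith

theorem lastIndex_add_one_le {n : ℕ} (hn : 1 ≤ n) :
    (lastIndex n : ℝ) + 1 ≤ 3 * (1 + Real.log n) := by
  have hn1 : (1 : ℝ) ≤ n := by exact_mod_cast hn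
  have h0 : 0 ≤ Real.log n := Real.log_nonneg hn1
  have h1 : (lastIndex n : ℝ) < Real.logb 2 n + 1 := by
    have h := Nat.ceil_lt_add_one (Real.logb_nonneg (b := 2) (by norm_num) hn1)
    rwa [← Nat.cast_ofNat, Real.natCeil_logb_natCast] at h
  have h2 : Real.logb 2 n ≤ 2 * Real.log n := by
    rw [Real.logb, div_le_iff₀ (Real.log_pos (by norm_num))]
    nlinarith [Real.log_two_gt_d9]
  linarith

/-- The crude bounds `log x ≤ x - 1` and `√x ≤ x` cost only powers of `k + 1`. That `log(1/δ)` is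
bounded below by `1/b` keeps the quotient of logarithms under control as `δ` approaches `δ₀`. -/
theorem callTime_le {n : ℕ} {c δ b : ℝ} (hn : 1 ≤ n) (hc : 0 < c) (hδ : 0 < δ) (hδ1 : δ < 1)
    (hb : 1 ≤ b * Real.log (1 / δ)) :
    (callTime n c δ : ℝ) ≤ (c * (1 + 2 * b) + 1) * n * (lastIndex n + 1) ^ 2 := by
  have h1 := log_callFailure_pos (n := n) hδ hδ1
  have h2 : 0 < Real.log (1 / δ) := Real.log_pos ((one_lt_div hδ).2 hδ1)
  have hn0 : (1 : ℝ) ≤ n := by exact_mod_cast hn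
  have hb0 : 0 < b := pos_of_mul_pos_left (by linarith) h2.le
  have hk : (1 : ℝ) ≤ lastIndex n + 1 := by linarith [(Nat.cast_nonneg (lastIndex n) : (0 : ℝ) ≤ _)]
  set k : ℝ := lastIndex n + 1 with hkdef
  have h3 : Real.log (1 / callFailure n δ) / Real.log (1 / δ) ≤ (1 + 2 * b) * k := by
    rw [div_le_iff₀ h2, log_callFailure hδ, ← hkdef]
    have h4 := Real.log_le_sub_one_of_pos (x := 2 * k) (by positivity)
    have h5 : 2 * k * 1 ≤ 2 * k * (b * Real.log (1 / δ)) := by gcongr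
    have h6 : 1 * Real.log (1 / δ) ≤ k * Real.log (1 / δ) := by gcongr
    linarith
  have h4 : Real.sqrt k ≤ k := by
    rw [Real.sqrt_le_left (by linarith)]
    nlinarith
  have h5 : c * n * Real.sqrt k * (Real.log (1 / callFailure n δ) / Real.log (1 / δ)) ≤
      c * n * k * ((1 + 2 * b) * k) := by gcongr
  have h6 : (callTime n c δ : ℝ) <
      c * n * Real.sqrt k * (Real.log (1 / callFailure n δ) / Real.log (1 / δ)) + 1 :=
    Nat.ceil_lt_add_one (by positivity)
  have h7 : 1 ≤ n * k ^ 2 := by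
    have := one_le_pow₀ hk (n := 2)
    nlinarith
  nlinarith

theorem segment_mem_Icc {L : Type} {Y : L → ℝ} (hY : ∀ y, 0 ≤ Y y) {n : ℕ} {B : ℝ} (hn : 1 ≤ n) (hB : 0 < B)
    (l : ℕ) (y : L) :
    0 ≤ (if gridLeft n B l ≤ Y y ∧ Y y < grid n B l then Y y / grid n B l else 0) ∧
      (if gridLeft n B l ≤ Y y ∧ Y y < grid n B l then Y y / grid n B l else 0) ≤ 1 := by
  have h := grid_pos hn hB l
  split_ifs with hy
  · exact ⟨div_nonneg (hY y) h.le, (div_le_one h).2 hy.2.le⟩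
  · norm_num

theorem QBME_queries_le {QME : EstimatorFamily} {C' : ℝ} {z : L × W} {Y : L → ℝ} {n : ℕ}
    {c B δ : ℝ}
    (hQME : ∀ f : L → ℝ, (∀ l, 0 ≤ f l ∧ f l ≤ 1) →
      ((QME L W z f (callTime n c δ) (callFailure n δ)).queries : ℝ) ≤ C' * callTime n c δ)
    (hY : ∀ y, 0 ≤ Y y) (hn : 1 ≤ n) (hB : 0 < B) :
    (QBME QME z Y n c B δ).queries ≤ (lastIndex n + 1) * ⌊C' * callTime n c δ⌋₊ := by
  refine QAlg.sumRuns_queries_le _ fun l => ?_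
  refine (QAlg.queries_bind_le (m := 0) _ fun m => by simp [QAlg.queries]).trans ?_
  exact Nat.le_floor (hQME _ (segment_mem_Icc hY hn hB l))

theorem QBME_law_le {QME : EstimatorFamily} {C c B δ b v : ℝ} {z : L × W} {Y p : L → ℝ} {n : ℕ}
    {O : Matrix.unitaryGroup (L × W) ℂ} (hC : 0 ≤ C)
    (hQME : ∀ f : L → ℝ, (∀ l, 0 ≤ f l ∧ f l ≤ 1) →
      ((QME L W z f (callTime n c δ) (callFailure n δ)).law O).toOuterMeasure
        {x | |x - ∑ l, p l * f l| ≤ C * (Real.sqrt (∑ l, p l * f l) *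
          Real.log (1 / callFailure n δ) / callTime n c δ +
            Real.log (1 / callFailure n δ) ^ 2 / (callTime n c δ : ℝ) ^ 2)}ᶜ ≤
      ENNReal.ofReal (callFailure n δ))
    (hp : ∀ y, 0 ≤ p y) (hp1 : ∑ y, p y = 1) (hY : ∀ y, 0 ≤ Y y) (hn : 1 ≤ n) (hB : 0 < B)
    (hc : 0 < c) (hδ : 0 < δ) (hδ1 : δ < 1) (hb : 1 ≤ b * Real.log (1 / δ))
    (hv : 0 < v) (hv1 : v ≤ 1)
    (hu : ∑ y, p y * Y y ^ (1 + v) ≤ B ^ (1 + v) * (Real.log (1 / δ) / n) ^ 2) :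
    ((QBME QME z Y n c B δ).law O).toOuterMeasure
        {x | |x - ∑ y, p y * Y y| ≤
          (C * ((2 + b) / c + 1 / c ^ 2) + 1) * (B * (Real.log (1 / δ) / n) ^ 2)}ᶜ ≤
      ENNReal.ofReal (δ / 2) := by
  have hδ' := callFailure_pos (n := n) hδ
  have hlog' := log_callFailure_pos (n := n) hδ hδ1
  have hlog : 0 < Real.log (1 / δ) := Real.log_pos ((one_lt_div hδ).2 hδ1)
  have hn0 : (0 : ℝ) < n := by exact_mod_cast hn
  have hb0 : 0 < b := pos_of_mul_pos_left (by linarith) hlog.le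
  set s := Real.log (1 / callFailure n δ) / callTime n c δ with hs
  have hcall (l : ℕ) (hl : l < lastIndex n + 1) :
      (QAlg.law O ((QME L W z
        (fun y => if gridLeft n B l ≤ Y y ∧ Y y < grid n B l then Y y / grid n B l else 0)
        (callTime n c δ) (callFailure n δ)).bind
          fun m => QAlg.output (grid n B l * m))).toOuterMeasure
        {x | |x - grid n B l * segmentMean p Y n B l| ≤
          C * (grid n B l * (Real.sqrt (segmentMean p Y n B l) * s + s ^ 2))}ᶜ ≤
        ENNReal.ofReal (callFailure n δ) := by
    rw [QAlg.law_bind, ← add_zero (ENNReal.ofReal _)]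
    refine toOuterMeasure_bind_le _ _ (hQME _ (segment_mem_Icc hY hn hB l)) fun m hm => ?_
    rw [QAlg.law, toOuterMeasure_pure_of_notMem]
    rw [Set.notMem_compl_iff, Set.mem_ofPred_eq] at hm ⊢
    have hg := grid_pos hn hB l
    rw [← mul_sub, abs_mul, abs_of_pos hg]
    refine (mul_le_mul_of_nonneg_left hm hg.le).trans (le_of_eq ?_)
    rw [hs, segmentMean]
    ring
  have h1 := QAlg.sumRuns_law_le O _ hcall
  -- The `k + 1` calls for one sign use up half of the failure budget.
  have h2 : (((lastIndex n + 1 : ℕ) : ENNReal) * ENNReal.ofReal (callFailure n δ)) =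
      ENNReal.ofReal (δ / 2) := by
    rw [← ENNReal.ofReal_natCast, ← ENNReal.ofReal_mul (by positivity), callFailure]
    congr 1
    push_cast
    field_simp
  rw [h2] at h1
  refine (MeasureTheory.OuterMeasure.mono _ ?_).trans h1
  refine Set.compl_subset_compl.2 fun x hx => ?_
  rw [Set.mem_ofPred_eq, sum_grid_mul_segmentMean hY hn hB, ← Finset.mul_sum] at hx
  rw [Set.mem_ofPred_eq]
  have h3 := sum_call_error_le (s := s) hp hp1 hY hn hB hv hv1 (div_pos hlog hn0) hc hb0.le
    (by rw [← mul_div_assoc]; gcongr) (by positivity) (callTime_ratio_le hn hc hδ hδ1) hu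
  have h4 := abs_sum_truncated_sub_le hp hY hB hv hu
  have h5 := abs_sub_le x (∑ y, p y * (if Y y < B then Y y else 0)) (∑ y, p y * Y y)
  have h6 := mul_le_mul_of_nonneg_left h3 hC
  linarith

theorem truncLevel_pos {u v δ : ℝ} {n : ℕ} (hn : 1 ≤ n) (hu : 0 < u) (hδ : 0 < δ) (hδ1 : δ < 1) :
    0 < truncLevel u v n δ := by
  have hlog : 0 < Real.log (1 / δ) := Real.log_pos ((one_lt_div hδ).2 hδ1)
  have hn0 : (0 : ℝ) < n := by exact_mod_cast hn
  have := Real.sqrt_pos.2 hu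
  exact Real.rpow_pos_of_pos (by positivity) _

/-- The defining property of `B`: it gives the moment hypothesis of the segment estimates with `ρ =
log(1/δ)/n`. -/
theorem truncLevel_rpow {u v δ : ℝ} {n : ℕ} (hn : 1 ≤ n) (hu : 0 < u) (hv : 0 < v) (hδ : 0 < δ)
    (hδ1 : δ < 1) : truncLevel u v n δ ^ (1 + v) * (Real.log (1 / δ) / n) ^ 2 = u := by
  have hlog : 0 < Real.log (1 / δ) := Real.log_pos ((one_lt_div hδ).2 hδ1)
  have hn0 : (0 : ℝ) < n := by exact_mod_cast hn
  rw [truncLevel, ← Real.rpow_mul (by positivity), div_mul_cancel₀ _ (by linarith : (1 + v) ≠ 0),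
    Real.rpow_two, ← mul_pow]
  rw [show Real.sqrt u * n / Real.log (1 / δ) * (Real.log (1 / δ) / n) = Real.sqrt u by field_simp,
    Real.sq_sqrt hu.le]

theorem truncLevel_mul {u v δ : ℝ} {n : ℕ} (hn : 1 ≤ n) (hu : 0 < u) (hv : 0 < v) (hδ : 0 < δ)
    (hδ1 : δ < 1) :
    truncLevel u v n δ * (Real.log (1 / δ) / n) ^ 2 =
      u ^ (1 / (1 + v)) * Real.log (1 / δ) ^ (2 * v / (1 + v)) / (n : ℝ) ^ (2 * v / (1 + v)) := by
  have hlog : 0 < Real.log (1 / δ) := Real.log_pos ((one_lt_div hδ).2 hδ1)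
  have hn0 : (0 : ℝ) < n := by exact_mod_cast hn
  have hv1 : 1 + v ≠ 0 := by linarith
  have h1 : 2 * v / (1 + v) = 2 - 2 / (1 + v) := by
    field_simp
    ring
  rw [truncLevel, Real.div_rpow (by positivity) hlog.le, Real.mul_rpow (by positivity) hn0.le,
    Real.sqrt_eq_rpow, ← Real.rpow_mul hu.le, h1, Real.rpow_sub hlog, Real.rpow_sub hn0,
    Real.rpow_two, Real.rpow_two, show 1 / 2 * (2 / (1 + v)) = 1 / (1 + v) by field_simp]
  have h2 := Real.rpow_pos_of_pos hlog (2 / (1 + v))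
  have h3 := Real.rpow_pos_of_pos hn0 (2 / (1 + v))
  field_simp

/-- The properties of the truncated mean estimator, for a variable on a finite set. -/
theorem QTME_spec {QME : EstimatorFamily} (hQME : IsQME QME) {δ₀ c : ℝ} (hδ₀ : δ₀ < 1)
    (hc : 0 < c) :
    ∃ C : ℝ, ∀ (L W : Type) [Fintype L] [DecidableEq L] [Fintype W] [DecidableEq W]
      (z : L × W) (O : Matrix.unitaryGroup (L × W) ℂ) (p x : L → ℝ) (u v δ : ℝ) (n : ℕ),
      (∀ l, 0 ≤ p l) → Encodes O z p → 0 < u → 0 < v → v ≤ 1 →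
      ∑ l, p l * |x l| ^ (1 + v) ≤ u → 0 < δ → δ ≤ δ₀ → 1 ≤ n →
      ((QTME QME z x n c (truncLevel u v n δ) δ).queries : ℝ) ≤ C * n * (1 + Real.log n) ^ 3 ∧
      ((QTME QME z x n c (truncLevel u v n δ) δ).law O).toOuterMeasure
        {y | |y - ∑ l, p l * x l| ≤ C * (u ^ (1 / (1 + v)) *
          Real.log (1 / δ) ^ (2 * v / (1 + v)) / (n : ℝ) ^ (2 * v / (1 + v)))}ᶜ ≤
        ENNReal.ofReal δ := by
  obtain ⟨C₀, C₁, hQ⟩ := hQME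
  by_cases hδ₀0 : δ₀ ≤ 0
  -- For `δ₀ ≤ 0` no `δ` is admissible.
  · exact ⟨0, fun _ _ _ _ _ _ _ _ _ _ _ _ _ _ _ _ _ _ _ _ hδ hδ' => by linarith⟩
  rw [not_le] at hδ₀0
  have hlog₀ : 0 < Real.log (1 / δ₀) := Real.log_pos ((one_lt_div hδ₀0).2 hδ₀)
  set b := 1 / Real.log (1 / δ₀) with hbdef
  have hb0 : 0 < b := by positivity
  -- The constants of the subroutine are not assumed non-negative.
  set D := max C₀ 0
  set D' := max C₁ 0
  -- The outer `2` counts the positive and negative parts; the `1` is the truncation bias.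
  set E := 2 * (D * ((2 + b) / c + 1 / c ^ 2) + 1) with hE
  -- `54 = 2 · 3³`: two signs, and `k + 1 ≤ 3 (1 + log n)` cubed.
  set E' := 54 * D' * (c * (1 + 2 * b) + 1) with hE'
  refine ⟨max E E', ?_⟩
  intro L W _ _ _ _ z O p x u v δ n hp hO hu hv hv1 hxu hδ hδδ₀ hn
  have hδ1 : δ < 1 := hδδ₀.trans_lt hδ₀
  have hn0 : (1 : ℝ) ≤ n := by exact_mod_cast hn
  have hlogn : 0 ≤ Real.log n := Real.log_nonneg hn0
  have hb : 1 ≤ b * Real.log (1 / δ) := by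
    rw [hbdef, one_div_mul_eq_div, one_le_div hlog₀]
    exact Real.log_le_log (by positivity) (one_div_le_one_div_of_le hδ hδδ₀)
  have hB := truncLevel_pos (v := v) hn hu hδ hδ1
  have hT := truncLevel_mul hn hu hv hδ hδ1
  have hBu := truncLevel_rpow hn hu hv hδ hδ1
  set B := truncLevel u v n δ
  have ht := callTime_pos hn hc hδ hδ1
  have ht0 : (0 : ℝ) < callTime n c δ := by exact_mod_cast ht
  have hδ' := callFailure_pos (n := n) hδ
  have hδ'2 : callFailure n δ ≤ 1 / 2 := by linarith [callFailure_le (n := n) hδ]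
  have hlog' := log_callFailure_pos (n := n) hδ hδ1
  have hq (f : L → ℝ) (hf : ∀ l, 0 ≤ f l ∧ f l ≤ 1) :
      ((QME L W z f (callTime n c δ) (callFailure n δ)).queries : ℝ) ≤ D' * callTime n c δ :=
    (hQ L W z f _ _ hf ht hδ' hδ'2).1.trans (by gcongr; exact le_max_left _ _)
  have hl (f : L → ℝ) (hf : ∀ l, 0 ≤ f l ∧ f l ≤ 1) :
      ((QME L W z f (callTime n c δ) (callFailure n δ)).law O).toOuterMeasure
        {x | |x - ∑ l, p l * f l| ≤ D * (Real.sqrt (∑ l, p l * f l) *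
          Real.log (1 / callFailure n δ) / callTime n c δ +
            Real.log (1 / callFailure n δ) ^ 2 / (callTime n c δ : ℝ) ^ 2)}ᶜ ≤
      ENNReal.ofReal (callFailure n δ) := by
    have h1 := (hQ L W z f _ _ hf ht hδ' hδ'2).2 O p hp hO
    rw [one_sub_le_toMeasure_iff _ (measurableSet_le (by fun_prop) (by fun_prop)) hδ'.le] at h1
    refine (MeasureTheory.OuterMeasure.mono _ (Set.compl_subset_compl.2 fun y hy => ?_)).trans h1
    rw [Set.mem_ofPred_eq] at hy ⊢
    exact hy.trans (by gcongr; exact le_max_left _ _)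
  have hpos (y : L) : 0 ≤ if 0 ≤ x y then x y else 0 := by split_ifs <;> linarith
  have hneg (y : L) : 0 ≤ if x y < 0 then -x y else 0 := by split_ifs <;> linarith
  have hmom {Y : L → ℝ} (hY : ∀ y, 0 ≤ Y y) (hYx : ∀ y, Y y ≤ |x y|) :
      ∑ y, p y * Y y ^ (1 + v) ≤ B ^ (1 + v) * (Real.log (1 / δ) / n) ^ 2 := by
    rw [hBu]
    refine (Finset.sum_le_sum fun y _ => ?_).trans hxu
    exact mul_le_mul_of_nonneg_left (Real.rpow_le_rpow (hY y) (hYx y) (by linarith)) (hp y)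
  have hpos_le (y : L) : (if 0 ≤ x y then x y else 0) ≤ |x y| := by
    split_ifs
    · exact le_abs_self _
    · exact abs_nonneg _
  have hneg_le (y : L) : (if x y < 0 then -x y else 0) ≤ |x y| := by
    split_ifs
    · exact neg_le_abs _
    · exact abs_nonneg _
  constructor
  · have h1 : (QTME QME z x n c B δ).queries ≤
        2 * ((lastIndex n + 1) * ⌊D' * callTime n c δ⌋₊) := by
      rw [two_mul]
      refine (QAlg.queries_bind_le _ fun m => ?_).trans
        (Nat.add_le_add_right (QBME_queries_le hq hpos hn hB) _)
      refine (QAlg.queries_bind_le (m := 0) _ fun m => by simp [QAlg.queries]).trans ?_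
      exact QBME_queries_le hq hneg hn hB
    have h2 : (⌊D' * callTime n c δ⌋₊ : ℝ) ≤ D' * callTime n c δ := Nat.floor_le (by positivity)
    have h3 := callTime_le hn hc hδ hδ1 hb
    have h4 := lastIndex_add_one_le hn
    calc ((QTME QME z x n c B δ).queries : ℝ)
        ≤ 2 * ((lastIndex n + 1) * ⌊D' * callTime n c δ⌋₊) := by exact_mod_cast h1
      _ ≤ 2 * ((lastIndex n + 1) *
            (D' * ((c * (1 + 2 * b) + 1) * n * (lastIndex n + 1) ^ 2))) := by
          gcongr
          exact h2.trans (by gcongr)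
      _ = 2 * D' * (c * (1 + 2 * b) + 1) * n * (lastIndex n + 1) ^ 3 := by ring
      _ ≤ 2 * D' * (c * (1 + 2 * b) + 1) * n * (3 * (1 + Real.log n)) ^ 3 := by gcongr
      _ = E' * n * (1 + Real.log n) ^ 3 := by rw [hE']; ring
      _ ≤ max E E' * n * (1 + Real.log n) ^ 3 := by
          gcongr
          exact le_max_right _ _
  · rw [← hT, QTME, QAlg.law_bind, ← add_halves δ,
      ENNReal.ofReal_add (by positivity) (by positivity), add_halves δ]
    have hp1 := hO.sum_eq_one hp
    refine toOuterMeasure_bind_le _ _ (QBME_law_le (le_max_right _ _) hl hp hp1 hpos hn hB hc hδ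
      hδ1 hb hv hv1 (hmom hpos hpos_le)) fun m hm => ?_
    rw [QAlg.law_bind, ← add_zero (ENNReal.ofReal _)]
    refine toOuterMeasure_bind_le _ _ (QBME_law_le (le_max_right _ _) hl hp hp1 hneg hn hB hc hδ
      hδ1 hb hv hv1 (hmom hneg hneg_le)) fun m' hm' => ?_
    rw [QAlg.law, toOuterMeasure_pure_of_notMem]
    rw [Set.notMem_compl_iff, Set.mem_ofPred_eq] at hm hm' ⊢
    have h1 : ∑ l, p l * x l = ∑ y, p y * (if 0 ≤ x y then x y else 0) -
        ∑ y, p y * (if x y < 0 then -x y else 0) := by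
      rw [← Finset.sum_sub_distrib]
      refine Finset.sum_congr rfl fun y _ => ?_
      rcases le_or_gt 0 (x y) with h | h
      · simp [h, not_lt.2 h]
      · simp [h, not_le.2 h]
    have h2 : E * (B * (Real.log (1 / δ) / n) ^ 2) ≤
        max E E' * (B * (Real.log (1 / δ) / n) ^ 2) := by
      gcongr
      exact le_max_left _ _
    rw [h1]
    refine le_trans ?_ h2
    rw [abs_le] at *
    constructor <;> rw [hE] <;> linarith

end Estimator

/-! ### From a random variable with finitely many values to sums over its values. -/

theorem integral_eq_sum_of_forall_mem {Ω : Type*} [MeasurableSpace Ω] (P : Measure Ω)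
    [IsProbabilityMeasure P] {X : Ω → ℝ} {S : Finset ℝ} (hX : Measurable X) (hS : ∀ ω, X ω ∈ S)
    (g : ℝ → ℝ) : ∫ ω, g (X ω) ∂P = ∑ y : S, P.real (X ⁻¹' {(y : ℝ)}) * g y := by
  have hm (y : ℝ) : MeasurableSet (X ⁻¹' {y}) := hX (measurableSet_singleton y)
  have h1 (ω : Ω) : g (X ω) = ∑ y : S, (X ⁻¹' {(y : ℝ)}).indicator (fun _ => g y) ω := by
    rw [Finset.sum_eq_single ⟨X ω, hS ω⟩]
    · simp
    · intro y _ hy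
      refine Set.indicator_of_notMem (fun h => hy (Subtype.ext ?_)) _
      exact (Set.mem_singleton_iff.1 h).symm
    · simp
  simp_rw [h1]
  have hi (y : S) : Integrable ((X ⁻¹' {(y : ℝ)}).indicator fun _ => g y) P :=
    (integrable_const _).indicator (hm y)
  refine (integral_finsetSum Finset.univ fun y _ => hi y).trans ?_
  refine Finset.sum_congr rfl fun y _ => ?_
  rw [integral_indicator_const _ (hm y), smul_eq_mul]

end QTMean

end

theorem theorem2 :
    ∃ QME : QTMean.EstimatorFamily, QTMean.IsQME QME ∧
      ∀ δ₀ c : ℝ, δ₀ < 1 → 0 < c →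
      ∃ (C : ℝ) (r : ℕ),
        ∀ (Ω : Type*) [MeasurableSpace Ω] (P : Measure Ω) [IsProbabilityMeasure P]
          (X : Ω → ℝ) (S : Finset ℝ) (W : Type) [Fintype W] [DecidableEq W]
          (z : S × W) (O : Matrix.unitaryGroup (S × W) ℂ) (u v δ : ℝ) (n : ℕ),
          Measurable X → (∀ ω, X ω ∈ S) →
          QTMean.Encodes O z (fun y : S => P.real (X ⁻¹' {(y : ℝ)})) →
          0 < u → 0 < v → v ≤ 1 → ∫ ω, |X ω| ^ (1 + v) ∂P ≤ u →
          0 < δ → δ ≤ δ₀ → 1 ≤ n →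
          ((QTMean.QTME QME z (fun y : S => (y : ℝ)) n c
              (QTMean.truncLevel u v n δ) δ).queries : ℝ)
            ≤ C * n * (1 + Real.log n) ^ r ∧
          ENNReal.ofReal (1 - δ) ≤
            ((QTMean.QTME QME z (fun y : S => (y : ℝ)) n c
                (QTMean.truncLevel u v n δ) δ).law O).toMeasure
              {x | |x - ∫ ω, X ω ∂P| ≤
                C * (u ^ (1 / (1 + v)) * Real.log (1 / δ) ^ (2 * v / (1 + v))
                  / (n : ℝ) ^ (2 * v / (1 + v)))} := by
  refine ⟨QTMean.medianEstimator, QTMean.isQME_medianEstimator, fun δ₀ c hδ₀ hc => ?_⟩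
  obtain ⟨C, hC⟩ := QTMean.QTME_spec QTMean.isQME_medianEstimator hδ₀ hc
  -- One logarithmic factor comes from the number of calls and two from the time parameter.
  refine ⟨C, 3, ?_⟩
  intro Ω _ P _ X S W _ _ z O u v δ n hX hS hO hu hv hv1 hXu hδ hδδ₀ hn
  have h := hC S W z O (fun y => P.real (X ⁻¹' {(y : ℝ)})) (fun y => (y : ℝ)) u v δ n
    (fun _ => measureReal_nonneg) hO hu hv hv1
    ((QTMean.integral_eq_sum_of_forall_mem P hX hS fun y => |y| ^ (1 + v)).symm.trans_le hXu)
    hδ hδδ₀ hn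
  rw [← QTMean.integral_eq_sum_of_forall_mem P hX hS fun y => y] at h
  refine ⟨h.1, ?_⟩
  rw [QTMean.one_sub_le_toMeasure_iff _ (measurableSet_le (by fun_prop) (by fun_prop)) hδ.le]
  exact h.2
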